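/- Conventions. For a finite totally ordered set $\{0<\dots<m\}$ let $\mathfrak C[\Delta^m]$ be the simplicial category with objects $0,\dots,m$ whose mapping simplicial set from $i$ to $j$ is the nerve of the poset of subsets of $[i,j]$ containing $i$ and $j$ (composition is union). Let $\mathfrak C(S)=\operatorname{colim}_{\Delta^m\to S}\mathfrak C[\Delta^m]$ be the path category of a simplicial set $S$, i.e. the value at $S$ of the left adjoint of the coherent nerve, and let $\mathrm F_{\mathfrak D}(x,y)$ denote the mapping simplicial sets of a simplicial category $\mathfrak D$. For a map of simplicial sets $p\colon X\to S$ let $S_p=S\cup_X (X*\Delta^0)$ be the pushout of $p$ along $X\to X*\Delta^0$, let $*\in S_p$ be the image of the vertex of $\Delta^0$, and let $\mathrm{Str}(p)\colon\mathfrak C(S)^{\mathrm{op}}\to\mathrm{sSet}$ be the simplicial functor $s\mapsto \mathrm F_{\mathfrak C(S_p)}(s,*)$. This defines the straightening functor $$\mathrm{Str}\colon \mathrm{sSet}/S\longrightarrow \mathrm{Fun}^{s}(\mathfrak C(S)^{\mathrm{op}},\mathrm{sSet})$$ into the category of simplicially enriched functors and simplicially enriched natural transformations. For a simplicial functor $f\colon\mathfrak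 A\to\mathfrak B$ let $f^{\mathrm{op}}_!\colon \mathrm{Fun}^{s}(\mathfrak A^{\mathrm{op}},\mathrm{sSet})\to\mathrm{Fun}^{s}(\mathfrak B^{\mathrm{op}},\mathrm{sSet})$ be enriched left Kan extension, the left adjoint of restriction along $f^{\mathrm{op}}$. Proposition. For every simplicial set $S$ the functor $\mathrm{Str}\colon \mathrm{sSet}/S\to\mathrm{Fun}^{s}(\mathfrak C(S)^{\mathrm{op}},\mathrm{sSet})$ preserves (small) colimits. It is compatible with base change: for every map $p\colon X\to S$ of simplicial sets, the canonical transformation $$\mathfrak C(p)^{\mathrm{op}}_!\,\mathrm{Str}(p')\longrightarrow \mathrm{Str}(p\circ p'),$$ natural in $p'\colon Y\to X$ in $\mathrm{sSet}/X$ and adjoint to the maps $\mathrm F_{\mathfrak C(X_{p'})}(x,*)\to \mathrm F_{\mathfrak C(S_{p\circ p'})}(p(x),*)$ induced by $X_{p'}\to S_{p\circ p'}$, is an isomorphism. -/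

import Mathlib

open CategoryTheory Limits MonoidalCategory Opposite

universe u

namespace Straightening

/-- The vertices of a simplicial set. -/
abbrev Vert (S : SSet.{u}) : Type u := S.obj (op (.mk 0))

/-! ### Simplices of the mapping spaces of a simplicial category -/

section Mapping

variable {C : Type u} [EnrichedCategory SSet.{u} C]

/-- The identity of `x`, as a (degenerate) `k`-simplex of the mapping space of `x`. -/
def hid (x : C) (k : SimplexCategoryᵒᵖ) : (x ⟶[SSet.{u}] x).obj k :=
  (eId SSet.{u} x).app k PUnit.unit

/-- Composition (in diagrammatic order) of `k`-simplices of mapping spaces. -/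
def hcomp {x y z : C} {k : SimplexCategoryᵒᵖ} (f : (x ⟶[SSet.{u}] y).obj k)
    (g : (y ⟶[SSet.{u}] z).obj k) : (x ⟶[SSet.{u}] z).obj k :=
  (eComp SSet.{u} x y z).app k ⟨f, g⟩

lemma hid_hcomp {x y : C} {k : SimplexCategoryᵒᵖ} (f : (x ⟶[SSet.{u}] y).obj k) :
    hcomp (hid x k) f = f :=
  congrArg (fun φ => φ.app k f) (e_id_comp SSet.{u} x y)

lemma hcomp_assoc {w x y z : C} {k : SimplexCategoryᵒᵖ} (f : (w ⟶[SSet.{u}] x).obj k)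
    (g : (x ⟶[SSet.{u}] y).obj k) (h : (y ⟶[SSet.{u}] z).obj k) :
    hcomp (hcomp f g) h = hcomp f (hcomp g h) :=
  congrArg (fun φ => φ.app k ⟨f, g, h⟩) (e_assoc SSet.{u} w x y z)

lemma hcomp_hid {x y : C} {k : SimplexCategoryᵒᵖ} (f : (x ⟶[SSet.{u}] y).obj k) :
    hcomp f (hid y k) = f :=
  congrArg (fun φ => φ.app k f) (e_comp_id SSet.{u} x y)

lemma map_hid (x : C) {k k' : SimplexCategoryᵒᵖ} (β : k ⟶ k') :
    (x ⟶[SSet.{u}] x).map β (hid x k) = hid x k' :=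
  (NatTrans.naturality_apply (eId SSet.{u} x) β PUnit.unit).symm

lemma map_hcomp {x y z : C} {k k' : SimplexCategoryᵒᵖ} (β : k ⟶ k')
    (f : (x ⟶[SSet.{u}] y).obj k) (g : (y ⟶[SSet.{u}] z).obj k) :
    (x ⟶[SSet.{u}] z).map β (hcomp f g) =
      hcomp ((x ⟶[SSet.{u}] y).map β f) ((y ⟶[SSet.{u}] z).map β g) :=
  (NatTrans.naturality_apply (eComp SSet.{u} x y z) β
    (⟨f, g⟩ : ((x ⟶[SSet.{u}] y) ⊗ (y ⟶[SSet.{u}] z)).obj k)).symm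

variable {D : Type u} [EnrichedCategory SSet.{u} D] (F : EnrichedFunctor SSet.{u} C D)

/-- The action of a simplicial functor on `k`-simplices of mapping spaces. -/
def hmap {x y : C} {k : SimplexCategoryᵒᵖ} (f : (x ⟶[SSet.{u}] y).obj k) :
    (F.obj x ⟶[SSet.{u}] F.obj y).obj k :=
  (F.map x y).app k f

lemma hmap_hid (x : C) (k : SimplexCategoryᵒᵖ) : hmap F (hid x k) = hid (F.obj x) k :=
  congrArg (fun φ => φ.app k PUnit.unit) (F.map_id x)

lemma hmap_hcomp {x y z : C} {k : SimplexCategoryᵒᵖ} (f : (x ⟶[SSet.{u}] y).obj k)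
    (g : (y ⟶[SSet.{u}] z).obj k) : hmap F (hcomp f g) = hcomp (hmap F f) (hmap F g) :=
  congrArg (fun φ => φ.app k ⟨f, g⟩) (F.map_comp x y z)

lemma map_hmap {x y : C} {k k' : SimplexCategoryᵒᵖ} (β : k ⟶ k')
    (f : (x ⟶[SSet.{u}] y).obj k) :
    (F.obj x ⟶[SSet.{u}] F.obj y).map β (hmap F f) = hmap F ((x ⟶[SSet.{u}] y).map β f) :=
  (NatTrans.naturality_apply (F.map x y) β f).symm

end Mapping

/-! ### The path category -/

/-- The simplicial category `ℭ[Δᵐ]`: its objects are `0, …, m` and its mapping spaces are the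
nerves of the posets of subsets of `[i, j]` containing `i` and `j`. -/
abbrev Thick (m : SimplexCategory) : Type u :=
  SimplicialThickening (ULift.{u} (Fin (m.len + 1)))

/-- The cosimplicial structure of `m ↦ ℭ[Δᵐ]`. -/
abbrev Thick.map {m m' : SimplexCategory} (α : m ⟶ m') :
    EnrichedFunctor SSet.{u} (Thick.{u} m) (Thick.{u} m') :=
  SimplicialThickening.functor α.toOrderHom.uliftMap

/-- The `i`-th vertex of a simplex. -/
def vertex {S : SSet.{u}} {m : SimplexCategory} (z : S.obj (op m)) (i : Thick.{u} m) : Vert S :=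
  S.map (SimplexCategory.const (.mk 0) m i.as.down).op z

lemma vertex_app {S T : SSet.{u}} (f : S ⟶ T) {m : SimplexCategory} (z : S.obj (op m))
    (i : Thick.{u} m) : vertex (f.app _ z) i = f.app _ (vertex z i) :=
  (NatTrans.naturality_apply f _ z).symm

lemma vertex_map {S : SSet.{u}} {m m' : SimplexCategory} (α : m ⟶ m') (z : S.obj (op m'))
    (i : Thick.{u} m) : vertex (S.map α.op z) i = vertex z ((Thick.map α).obj i) := by
  unfold vertex
  rw [← Functor.map_comp_apply]
  rfl

/-- Formal words representing the `k`-simplices of the mapping space from `s` to `t` in `ℭ(S)`.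
The generators are the `k`-simplices of the mapping spaces of `ℭ[Δᵐ]`, for all simplices
`z : Δᵐ → S`. -/
inductive PreHom (S : SSet.{u}) (k : SimplexCategoryᵒᵖ) : Vert S → Vert S → Type u
  | of {s t : Vert S} (m : SimplexCategory) (z : S.obj (op m)) (i j : Thick.{u} m)
      (a : (i ⟶[SSet.{u}] j).obj k) (hs : vertex z i = s) (ht : vertex z j = t) : PreHom S k s t
  | id {s t : Vert S} (h : s = t) : PreHom S k s t
  | comp {r s t : Vert S} (f : PreHom S k r s) (g : PreHom S k s t) : PreHom S k r t

/-- The relations between the words: the axioms of a category (`id_comp`, `comp_id`, `assoc`,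
and compatibility with composition), the functoriality of `ℭ[Δᵐ] → ℭ(S)` for each simplex
`z : Δᵐ → S` (`of_id`, `of_comp`), and the compatibility of these functors with the simplicial
operators `α` (`of_map`). So `ℭ(S)` is the colimit of the `ℭ[Δᵐ]` over the simplices of `S`. -/
inductive PathRel (S : SSet.{u}) (k : SimplexCategoryᵒᵖ) :
    ∀ {s t : Vert S}, PreHom S k s t → PreHom S k s t → Prop
  | comp_left {r s t : Vert S} {f f' : PreHom S k r s} (g : PreHom S k s t) (h : PathRel S k f f') :
      PathRel S k (f.comp g) (f'.comp g)
  | comp_right {r s t : Vert S} (f : PreHom S k r s) {g g' : PreHom S k s t} (h : PathRel S k g g') :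
      PathRel S k (f.comp g) (f.comp g')
  | id_comp {s t : Vert S} (f : PreHom S k s t) : PathRel S k ((PreHom.id rfl).comp f) f
  | comp_id {s t : Vert S} (f : PreHom S k s t) : PathRel S k (f.comp (PreHom.id rfl)) f
  | assoc {q r s t : Vert S} (f : PreHom S k q r) (g : PreHom S k r s) (h : PreHom S k s t) :
      PathRel S k ((f.comp g).comp h) (f.comp (g.comp h))
  | of_id {s t : Vert S} (m : SimplexCategory) (z : S.obj (op m)) (i : Thick.{u} m)
      (hs : vertex z i = s) (ht : vertex z i = t) :
      PathRel S k (PreHom.of m z i i (hid i k) hs ht)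
        (PreHom.id (hs.symm.trans ht))
  | of_comp {r s t : Vert S} (m : SimplexCategory) (z : S.obj (op m)) (i j l : Thick.{u} m)
      (a : (i ⟶[SSet.{u}] j).obj k) (b : (j ⟶[SSet.{u}] l).obj k)
      (hr : vertex z i = r) (hs : vertex z j = s) (ht : vertex z l = t) :
      PathRel S k (PreHom.of m z i l (hcomp a b) hr ht)
        ((PreHom.of m z i j a hr hs).comp (PreHom.of m z j l b hs ht))
  | of_map {s t : Vert S} {m m' : SimplexCategory} (α : m ⟶ m') (z : S.obj (op m'))
      (i j : Thick.{u} m) (a : (i ⟶[SSet.{u}] j).obj k)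
      (hs : vertex (S.map α.op z) i = s) (ht : vertex (S.map α.op z) j = t) :
      PathRel S k (PreHom.of m (S.map α.op z) i j a hs ht)
        (PreHom.of m' z ((Thick.map α).obj i) ((Thick.map α).obj j)
          (hmap (Thick.map α) a)
          ((vertex_map α z i).symm.trans hs) ((vertex_map α z j).symm.trans ht))

/-- The action of the simplicial operators on words. -/
def PreHom.whisker {S : SSet.{u}} {k k' : SimplexCategoryᵒᵖ} (β : k ⟶ k') :
    ∀ {s t : Vert S}, PreHom S k s t → PreHom S k' s t
  | _, _, .of m z i j a hs ht => .of m z i j ((i ⟶[SSet.{u}] j).map β a) hs ht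
  | _, _, .id h => .id h
  | _, _, .comp f g => .comp (f.whisker β) (g.whisker β)

lemma PathRel.whisker {S : SSet.{u}} {k k' : SimplexCategoryᵒᵖ} (β : k ⟶ k') {s t : Vert S}
    {f g : PreHom S k s t} (h : PathRel S k f g) : PathRel S k' (f.whisker β) (g.whisker β) := by
  induction h with
  | comp_left g _ ih => exact .comp_left _ ih
  | comp_right f _ ih => exact .comp_right _ ih
  | id_comp f => exact .id_comp _
  | comp_id f => exact .comp_id _
  | assoc f g h => exact .assoc _ _ _
  | of_id m z i hs ht => exact .of_id m z i hs ht
  | of_comp m z i j l a b hr hs ht =>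
    exact .of_comp m z i j l ((i ⟶[SSet.{u}] j).map β a) ((j ⟶[SSet.{u}] l).map β b) hr hs ht
  | of_map α z i j a hs ht => exact .of_map α z i j ((i ⟶[SSet.{u}] j).map β a) hs ht

lemma PreHom.whisker_id {S : SSet.{u}} {k : SimplexCategoryᵒᵖ} {s t : Vert S}
    (f : PreHom S k s t) : f.whisker (𝟙 k) = f := by
  induction f with
  | of m z i j a hs ht => simp [whisker]
  | id h => rfl
  | comp f g hf hg => simp [whisker, hf, hg]

lemma PreHom.whisker_comp {S : SSet.{u}} {k k' k'' : SimplexCategoryᵒᵖ} (β : k ⟶ k')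
    (γ : k' ⟶ k'') {s t : Vert S}
    (f : PreHom S k s t) : f.whisker (β ≫ γ) = (f.whisker β).whisker γ := by
  induction f with
  | of m z i j a hs ht => simp [whisker]
  | id h => rfl
  | comp f g hf hg => simp [whisker, hf, hg]

/-- The mapping space from `s` to `t` in `ℭ(S)`. -/
def pathHom (S : SSet.{u}) (s t : Vert S) : SSet.{u} where
  obj k := Quot (PathRel S k (s := s) (t := t))
  map β := ↾Quot.map (PreHom.whisker β) (fun _ _ h => h.whisker β)
  map_id k := by
    ext ⟨f⟩
    exact congrArg (Quot.mk _) f.whisker_id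
  map_comp β γ := by
    ext ⟨f⟩
    exact congrArg (Quot.mk _) (f.whisker_comp β γ)

/-- The path category `ℭ(S)`; its objects are the vertices of `S`. -/
structure PathCat (S : SSet.{u}) : Type u where
  as : Vert S

/-- The simplicial enrichment of `ℭ(S)`, with composition given by concatenation of words. -/
instance (S : SSet.{u}) : EnrichedCategory SSet.{u} (PathCat S) where
  Hom s t := pathHom S s.as t.as
  id s := { app := fun k => ↾fun _ => Quot.mk _ (PreHom.id rfl) }
  comp r s t :=
    { app := fun k => ↾fun x => Quot.map₂ PreHom.comp (fun f _ _ h => .comp_right f h)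
        (fun _ _ g h => .comp_left g h) x.1 x.2
      naturality := fun k k' β => by
        ext ⟨⟨f⟩, ⟨g⟩⟩
        rfl }
  id_comp s t := by
    ext k ⟨f⟩
    exact Quot.sound (.id_comp f)
  comp_id s t := by
    ext k ⟨f⟩
    exact Quot.sound (.comp_id f)
  assoc q r s t := by
    ext k ⟨⟨f⟩, ⟨g⟩, ⟨h⟩⟩
    exact Quot.sound (.assoc f g h)


/-- The action of a map `f : S ⟶ T` on words. -/
def PreHom.map {S T : SSet.{u}} (f : S ⟶ T) {k : SimplexCategoryᵒᵖ} :
    ∀ {s t : Vert S}, PreHom S k s t → ∀ {s' t' : Vert T},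
      f.app _ s = s' → f.app _ t = t' → PreHom T k s' t'
  | _, _, .of m z i j a hs ht, _, _, hs', ht' => .of m (f.app _ z) i j a
      (by rw [vertex_app, hs, hs']) (by rw [vertex_app, ht, ht'])
  | _, _, .id h, _, _, hs', ht' => .id (by rw [← hs', ← ht', h])
  | _, _, .comp g h, _, _, hs', ht' => (g.map f hs' rfl).comp (h.map f rfl ht')

lemma PathRel.of_map' {S : SSet.{u}} {k : SimplexCategoryᵒᵖ} {s t : Vert S}
    {m m' : SimplexCategory} (α : m ⟶ m') (z : S.obj (op m')) (w : S.obj (op m))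
    (e : w = S.map α.op z) (i j : Thick.{u} m) (a : (i ⟶[SSet.{u}] j).obj k)
    (hs : vertex w i = s) (ht : vertex w j = t) :
    PathRel S k (PreHom.of m w i j a hs ht)
      (PreHom.of m' z ((Thick.map α).obj i) ((Thick.map α).obj j)
        (hmap (Thick.map α) a)
        (by rw [← hs, e, vertex_map]) (by rw [← ht, e, vertex_map])) := by
  subst e
  exact .of_map α z i j a hs ht

lemma PathRel.map {S T : SSet.{u}} (f : S ⟶ T) {k : SimplexCategoryᵒᵖ} {s t : Vert S}
    {g h : PreHom S k s t} (r : PathRel S k g h) {s' t' : Vert T}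
    (hs : f.app _ s = s') (ht : f.app _ t = t') :
    PathRel T k (g.map f hs ht) (h.map f hs ht) := by
  induction r generalizing s' t' with
  | comp_left g _ ih => exact .comp_left _ (ih _ _)
  | comp_right g _ ih => exact .comp_right _ (ih _ _)
  | id_comp g => subst hs; exact .id_comp _
  | comp_id g => subst ht; exact .comp_id _
  | assoc g h l => exact .assoc _ _ _
  | of_id m z i _ _ => exact .of_id m _ i _ _
  | of_comp m z i j l a b _ _ _ => exact .of_comp m _ i j l a b _ _ _
  | @of_map s t m m' α z i j a _ _ =>
    exact .of_map' α (f.app (op m') z) _ (NatTrans.naturality_apply f α.op z) i j a _ _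

lemma PreHom.map_whisker {S T : SSet.{u}} (f : S ⟶ T) {k k' : SimplexCategoryᵒᵖ} (β : k ⟶ k')
    {s t : Vert S} (g : PreHom S k s t) {s' t' : Vert T}
    (hs : f.app _ s = s') (ht : f.app _ t = t') :
    (g.whisker β).map f hs ht = (g.map f hs ht).whisker β := by
  induction g generalizing s' t' with
  | of m z i j a _ _ => rfl
  | id h => rfl
  | comp g h hg hh => simp [whisker, map, hg, hh]

/-- The map from the mapping space from `s` to `t` in `ℭ(S)` to the one from `f s` to `f t` in
`ℭ(T)`, with the equalities `f s = s'` and `f t = t'` built in. -/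
def pathMap {S T : SSet.{u}} (f : S ⟶ T) {s t : Vert S} {s' t' : Vert T}
    (hs : f.app _ s = s') (ht : f.app _ t = t') : pathHom S s t ⟶ pathHom T s' t' where
  app k := ↾Quot.map (fun g => g.map f hs ht) (fun _ _ r => r.map f hs ht)
  naturality k k' β := by
    ext ⟨g⟩
    exact congrArg (Quot.mk _) (g.map_whisker f β hs ht)

lemma PreHom.map_map {S T U : SSet.{u}} (f : S ⟶ T) (g : T ⟶ U) {k : SimplexCategoryᵒᵖ}
    {s t : Vert S} {s' t' : Vert T} {s'' t'' : Vert U} (x : PreHom S k s t)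
    (hs : f.app _ s = s') (ht : f.app _ t = t') (hs' : g.app _ s' = s'') (ht' : g.app _ t' = t'') :
    (x.map f hs ht).map g hs' ht' =
      x.map (f ≫ g) (by subst hs hs'; rfl) (by subst ht ht'; rfl) := by
  induction x generalizing s' t' s'' t'' with
  | of m z i j a _ _ => rfl
  | id h => rfl
  | comp x y hx hy =>
    simp only [map]
    rw [hx, hy]; rfl

lemma PreHom.map_id {S : SSet.{u}} {k : SimplexCategoryᵒᵖ} {s t : Vert S} (x : PreHom S k s t) :
    x.map (𝟙 S) rfl rfl = x := by
  induction x with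
  | of m z i j a _ _ => subst_vars; rfl
  | id h => rfl
  | comp x y hx hy => exact congrArg₂ PreHom.comp hx hy

lemma pathMap_id {S : SSet.{u}} (s t : Vert S) :
    pathMap (𝟙 S) (s := s) (t := t) rfl rfl = 𝟙 _ := by
  ext k ⟨x⟩
  exact congrArg (Quot.mk _) x.map_id

lemma pathMap_comp {S T U : SSet.{u}} (f : S ⟶ T) (g : T ⟶ U) (l : S ⟶ U) (w : f ≫ g = l)
    {s t : Vert S} {s' t' : Vert T} {s'' t'' : Vert U}
    (hs : f.app _ s = s') (ht : f.app _ t = t') (hs' : g.app _ s' = s'') (ht' : g.app _ t' = t'')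
    (hs'' : l.app _ s = s'') (ht'' : l.app _ t = t'') :
    pathMap f hs ht ≫ pathMap g hs' ht' = pathMap l hs'' ht'' := by
  subst w
  ext k ⟨x⟩
  exact congrArg (Quot.mk _) (x.map_map f g hs ht hs' ht')

/-- The simplicial functor `ℭ(f) : ℭ(S) → ℭ(T)`. -/
def pathFunctor {S T : SSet.{u}} (f : S ⟶ T) :
    EnrichedFunctor SSet.{u} (PathCat S) (PathCat T) where
  obj s := ⟨f.app _ s.as⟩
  map s t := pathMap f rfl rfl
  map_id s := rfl
  map_comp r s t := by
    ext k ⟨⟨x⟩, ⟨y⟩⟩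
    rfl

lemma pathMap_hcomp {S T : SSet.{u}} (f : S ⟶ T) {r s t : PathCat S} {r' s' t' : PathCat T}
    (hr : f.app _ r.as = r'.as) (hs : f.app _ s.as = s'.as) (ht : f.app _ t.as = t'.as)
    {k : SimplexCategoryᵒᵖ} (x : (r ⟶[SSet.{u}] s).obj k) (y : (s ⟶[SSet.{u}] t).obj k) :
    (pathMap f hr ht).app k (hcomp x y) =
      hcomp (x := r') (y := s') (z := t') ((pathMap f hr hs).app k x)
        ((pathMap f hs ht).app k y) := by
  obtain ⟨s'⟩ := s'
  dsimp at hs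
  subst hs
  obtain ⟨x⟩ := x
  obtain ⟨y⟩ := y
  rfl

/-! ### The universal property of the path category -/

section Universal

variable {C D : Type u} [EnrichedCategory SSet.{u} C] [EnrichedCategory SSet.{u} D]

/-- Transport of simplices of mapping spaces along equalities of objects. -/
def hcast {x y x' y' : D} (hx : x = x') (hy : y = y') {k : SimplexCategoryᵒᵖ}
    (f : (x ⟶[SSet.{u}] y).obj k) : (x' ⟶[SSet.{u}] y').obj k :=
  hx ▸ hy ▸ f

lemma hcast_hid {x y z : D} (hx : x = y) (hy : x = z) (k : SimplexCategoryᵒᵖ) :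
    hcast hx hy (hid x k) = hcast rfl (hx.symm.trans hy) (hid y k) := by
  subst hx hy; rfl

lemma hcast_hcomp {x y z x' y' z' : D} (hx : x = x') (hy : y = y') (hz : z = z')
    {k : SimplexCategoryᵒᵖ} (f : (x ⟶[SSet.{u}] y).obj k) (g : (y ⟶[SSet.{u}] z).obj k) :
    hcast hx hz (hcomp f g) = hcomp (hcast hx hy f) (hcast hy hz g) := by
  subst hx hy hz; rfl

lemma hcast_hcast {x y x' y' x'' y'' : D} (hx : x = x') (hy : y = y') (hx' : x' = x'')
    (hy' : y' = y'') {k : SimplexCategoryᵒᵖ} (f : (x ⟶[SSet.{u}] y).obj k) :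
    hcast hx' hy' (hcast hx hy f) = hcast (hx.trans hx') (hy.trans hy') f := by
  subst hx hy hx' hy'; rfl

lemma map_hcast {x y x' y' : D} (hx : x = x') (hy : y = y') {k k' : SimplexCategoryᵒᵖ}
    (β : k ⟶ k') (f : (x ⟶[SSet.{u}] y).obj k) :
    (x' ⟶[SSet.{u}] y').map β (hcast hx hy f) = hcast hx hy ((x ⟶[SSet.{u}] y).map β f) := by
  subst hx hy; rfl

lemma hcast_hmap {F G : EnrichedFunctor SSet.{u} C D} (h : F = G) {x y : C}
    {k : SimplexCategoryᵒᵖ} (f : (x ⟶[SSet.{u}] y).obj k) :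
    hcast (congrArg (fun H => H.obj x) h) (congrArg (fun H => H.obj y) h) (hmap F f) =
      hmap G f := by
  subst h; rfl

lemma eFunctor_ext {F G : EnrichedFunctor SSet.{u} C D} (h : ∀ x, F.obj x = G.obj x)
    (h' : ∀ (x y : C) (k : SimplexCategoryᵒᵖ) (f : (x ⟶[SSet.{u}] y).obj k),
      hcast (h x) (h y) (hmap F f) = hmap G f) : F = G := by
  obtain ⟨Fo, Fm, _, _⟩ := F
  obtain ⟨Go, Gm, _, _⟩ := G
  obtain rfl : Fo = Go := funext h
  congr
  funext x y
  ext k f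
  exact h' x y k f

/-- The functor `ℭ[Δᵐ] → ℭ(S)` given by an `m`-simplex of `S`. -/
def pathIota {S : SSet.{u}} {m : SimplexCategory} (z : S.obj (op m)) :
    EnrichedFunctor SSet.{u} (Thick.{u} m) (PathCat S) where
  obj i := ⟨vertex z i⟩
  map i j :=
    { app := fun k => ↾fun a => Quot.mk _ (.of m z i j a rfl rfl)
      naturality := fun k k' β => rfl }
  map_id i := by
    ext k ⟨⟩
    exact Quot.sound (.of_id m z i rfl rfl)
  map_comp i j l := by
    ext k ⟨a, b⟩
    exact Quot.sound (.of_comp m z i j l a b rfl rfl rfl)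

section Desc

variable {S : SSet.{u}}
  {E : ∀ (m : SimplexCategory), S.obj (op m) → EnrichedFunctor SSet.{u} (Thick.{u} m) D}
  (hE : ∀ (m m' : SimplexCategory) (α : m ⟶ m') (z : S.obj (op m')),
    E m (S.map α.op z) = (Thick.map α).comp SSet.{u} (E m' z))

lemma desc_obj (hE : ∀ (m m' : SimplexCategory) (α : m ⟶ m') (z : S.obj (op m')),
    E m (S.map α.op z) = (Thick.map α).comp SSet.{u} (E m' z))
    {m : SimplexCategory} (z : S.obj (op m)) (i : Thick.{u} m) {s : Vert S}
    (h : vertex z i = s) : (E m z).obj i = (E (.mk 0) s).obj ⟨⟨0⟩⟩ := by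
  subst h
  unfold vertex
  rw [hE]
  rfl

/-- The value on words of the functor determined by a compatible family `E`. -/
def PreHom.desc {k : SimplexCategoryᵒᵖ} : ∀ {s t : Vert S}, PreHom S k s t →
    ((E (.mk 0) s).obj ⟨⟨0⟩⟩ ⟶[SSet.{u}] (E (.mk 0) t).obj ⟨⟨0⟩⟩).obj k
  | _, _, .of m z i j a hs ht =>
    hcast (desc_obj hE z i hs) (desc_obj hE z j ht) (hmap (E m z) a)
  | _, _, .id h => hcast rfl (by rw [h]) (hid _ k)
  | _, _, .comp f g => hcomp f.desc g.desc

lemma PathRel.desc {k : SimplexCategoryᵒᵖ} {s t : Vert S} {f g : PreHom S k s t}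
    (r : PathRel S k f g) : f.desc hE = g.desc hE := by
  induction r with
  | comp_left g _ ih => exact congrArg (fun f => hcomp f _) ih
  | comp_right f _ ih => exact congrArg (fun g => hcomp _ g) ih
  | id_comp f => exact hid_hcomp _
  | comp_id f => exact hcomp_hid _
  | assoc f g h => exact hcomp_assoc _ _ _
  | of_id m z i hs ht =>
    simp only [PreHom.desc, hmap_hid]
    exact hcast_hid _ _ _
  | of_comp m z i j l a b hr hs ht =>
    simp only [PreHom.desc, hmap_hcomp]
    exact hcast_hcomp _ _ _ _ _
  | of_map α z i j a hs ht =>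
    simp only [PreHom.desc]
    have e := hcast_hmap (hE _ _ α z) a
    refine Eq.trans ?_ (congrArg (hcast _ _) e)
    exact (hcast_hcast _ _ _ _ _).symm

lemma PreHom.map_desc {k k' : SimplexCategoryᵒᵖ} (β : k ⟶ k') {s t : Vert S}
    (f : PreHom S k s t) :
    ((E (.mk 0) s).obj ⟨⟨0⟩⟩ ⟶[SSet.{u}] (E (.mk 0) t).obj ⟨⟨0⟩⟩).map β (f.desc hE) =
      (f.whisker β).desc hE := by
  induction f with
  | of m z i j a hs ht => simp only [desc, whisker, map_hcast, map_hmap]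
  | id h => simp only [desc, whisker, map_hcast, map_hid]
  | comp f g hf hg => simp only [desc, whisker, map_hcomp, hf, hg]

/-- The functor `ℭ(S) → D` determined by a compatible family `E` of functors `ℭ[Δᵐ] → D`. -/
def pathDesc : EnrichedFunctor SSet.{u} (PathCat S) D where
  obj s := (E (.mk 0) s.as).obj ⟨⟨0⟩⟩
  map s t :=
    { app := fun k => ↾Quot.lift (PreHom.desc hE) (fun _ _ r => r.desc hE)
      naturality := fun k k' β => by
        ext ⟨f⟩
        exact (f.map_desc hE β).symm }
  map_id s := rfl
  map_comp r s t := by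
    ext k ⟨⟨f⟩, ⟨g⟩⟩
    rfl

lemma pathIota_pathDesc {m : SimplexCategory} (z : S.obj (op m)) :
    (pathIota z).comp SSet.{u} (pathDesc hE) = E m z := by
  refine (eFunctor_ext (fun i => desc_obj hE z i rfl) (fun i j k a => rfl)).symm

end Desc

/-- The path category is left adjoint to the coherent nerve: a map `φ : S → N(D)` amounts to
a compatible family of functors `ℭ[Δᵐ] → D` indexed by the simplices of `S`, and extends uniquely
to a simplicial functor `ℭ(S) → D`. -/
theorem pathCat_universal {S : SSet.{u}} {D : Type u} [Category.{u} D] [SimplicialCategory D]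
    (φ : S ⟶ SimplicialNerve D) :
    ∃! Φ : EnrichedFunctor SSet.{u} (PathCat S) D,
      ∀ (m : SimplexCategory) (z : S.obj (op m)),
        (pathIota z).comp SSet.{u} Φ = φ.app (op m) z := by
  refine ⟨pathDesc (E := fun m z => φ.app (op m) z)
    (fun m m' α z => NatTrans.naturality_apply φ α.op z),
    fun m z => pathIota_pathDesc _ z, fun Ψ hΨ => ?_⟩
  have key : ∀ (m : SimplexCategory) (z : S.obj (op m)),
      (pathIota z).comp SSet.{u} Ψ = (pathIota z).comp SSet.{u} (pathDesc
        (E := fun m z => φ.app (op m) z)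
        (fun m m' α z => NatTrans.naturality_apply φ α.op z)) :=
    fun m z => (hΨ m z).trans (pathIota_pathDesc (E := fun m z => φ.app (op m) z)
      (fun m m' α z => NatTrans.naturality_apply φ α.op z) z).symm
  generalize pathDesc (E := fun m z => φ.app (op m) z)
        (fun m m' α z => NatTrans.naturality_apply φ α.op z) = Φ at key
  have hv : ∀ s : Vert S, vertex s (⟨⟨0⟩⟩ : Thick.{u} (.mk 0)) = s := fun s => by
    unfold vertex
    rw [SimplexCategory.const_eq_id]
    simp
  have ho : ∀ s : PathCat S, Ψ.obj s = Φ.obj s := fun ⟨s⟩ => by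
    have := congrArg (fun H => H.obj (⟨⟨0⟩⟩ : Thick.{u} (.mk 0))) (key _ s)
    simpa [pathIota, hv] using this
  refine eFunctor_ext ho ?_
  rintro ⟨s⟩ ⟨t⟩ k f₀
  obtain ⟨f, rfl⟩ := Quot.exists_rep f₀
  revert f
  change ∀ f : PreHom S k s t, hcast (ho ⟨s⟩) (ho ⟨t⟩)
      (hmap Ψ (x := (⟨s⟩ : PathCat S)) (y := ⟨t⟩) (Quot.mk _ f)) =
    hmap Φ (x := (⟨s⟩ : PathCat S)) (y := ⟨t⟩) (Quot.mk _ f)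
  intro f
  induction f with
  | of m z i j a hs ht =>
    subst hs ht
    exact hcast_hmap (key m z) a
  | @id s t h =>
    subst h
    refine (congrArg (hcast _ _) (hmap_hid Ψ (⟨s⟩ : PathCat S) k)).trans ?_
    refine Eq.trans ?_ (hmap_hid Φ (⟨s⟩ : PathCat S) k).symm
    exact hcast_hid _ _ _
  | @comp r s t f g hf hg =>
    refine (congrArg (hcast _ _) (hmap_hcomp Ψ (x := (⟨r⟩ : PathCat S)) (y := ⟨s⟩) (z := ⟨t⟩)
      (Quot.mk _ f) (Quot.mk _ g))).trans ?_
    refine Eq.trans ?_ (hmap_hcomp Φ (x := (⟨r⟩ : PathCat S)) (y := ⟨s⟩) (z := ⟨t⟩)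
      (Quot.mk _ f) (Quot.mk _ g)).symm
    rw [← hf, ← hg]
    exact hcast_hcomp _ (ho ⟨s⟩) _ _ _

end Universal

/-! ### Simplicial presheaves and their left Kan extensions -/

/-- A simplicially enriched functor `P : Cᵒᵖ → sSet`. Its action on mapping spaces is given in the
form of the simplicial maps `F_C(x, y) × P y → P x` adjoint to `F_C(x, y) → F_sSet(P y, P x)`. -/
structure SPresheaf (C : Type u) [EnrichedCategory SSet.{u} C] where
  obj : C → SSet.{u}
  smul {x y : C} {k : SimplexCategoryᵒᵖ} (f : (x ⟶[SSet.{u}] y).obj k) (a : (obj y).obj k) :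
    (obj x).obj k
  map_smul {x y : C} {k k' : SimplexCategoryᵒᵖ} (β : k ⟶ k') (f : (x ⟶[SSet.{u}] y).obj k)
    (a : (obj y).obj k) :
    (obj x).map β (smul f a) = smul ((x ⟶[SSet.{u}] y).map β f) ((obj y).map β a)
  id_smul {x : C} {k : SimplexCategoryᵒᵖ} (a : (obj x).obj k) : smul (hid x k) a = a
  hcomp_smul {x y z : C} {k : SimplexCategoryᵒᵖ} (f : (x ⟶[SSet.{u}] y).obj k)
    (g : (y ⟶[SSet.{u}] z).obj k) (a : (obj z).obj k) :
    smul (hcomp f g) a = smul f (smul g a)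

namespace SPresheaf

variable {C : Type u} [EnrichedCategory SSet.{u} C]

/-- Simplicially enriched natural transformations, i.e. the vertices of the simplicial set of
natural transformations: they are compatible with all simplices of the mapping spaces of `C`. -/
@[ext]
structure Hom (P Q : SPresheaf C) where
  app (x : C) : P.obj x ⟶ Q.obj x
  app_smul {x y : C} {k : SimplexCategoryᵒᵖ} (f : (x ⟶[SSet.{u}] y).obj k)
    (a : (P.obj y).obj k) :
    (app x).app k (P.smul f a) = Q.smul f ((app y).app k a)

/-- The category `Fun(Cᵒᵖ, sSet)` of simplicial functors. -/
instance : Category (SPresheaf C) where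
  Hom := Hom
  id P := { app := fun x => 𝟙 _, app_smul := fun _ _ => rfl }
  comp α β :=
    { app := fun x => α.app x ≫ β.app x
      app_smul := fun {x y k} f a =>
        (congrArg ((β.app x).app k) (α.app_smul f a)).trans (β.app_smul f _) }

@[ext]
lemma hom_ext {P Q : SPresheaf C} {α β : P ⟶ Q} (h : ∀ x, α.app x = β.app x) : α = β :=
  Hom.ext (funext h)

@[simp]
lemma id_app (P : SPresheaf C) (x : C) : Hom.app (𝟙 P) x = 𝟙 (P.obj x) := rfl

@[simp]
lemma comp_app {P Q R : SPresheaf C} (α : P ⟶ Q) (β : Q ⟶ R) (x : C) :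
    (α ≫ β).app x = α.app x ≫ β.app x := rfl

/-- The representable functor `F_C(-, c)`. -/
def representable (c : C) : SPresheaf C where
  obj x := x ⟶[SSet.{u}] c
  smul f g := hcomp f g
  map_smul β f g := map_hcomp β f g
  id_smul f := hid_hcomp f
  hcomp_smul f g h := hcomp_assoc f g h

variable {D : Type u} [EnrichedCategory SSet.{u} D]

/-- Restriction `F^*` along a simplicial functor `F`. -/
def restrict (F : EnrichedFunctor SSet.{u} C D) : SPresheaf D ⥤ SPresheaf C where
  obj P :=
    { obj := fun x => P.obj (F.obj x)
      smul := fun f a => P.smul (hmap F f) a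
      map_smul := fun β f a => by rw [P.map_smul, map_hmap]
      id_smul := fun a => by rw [hmap_hid, P.id_smul]
      hcomp_smul := fun f g a => by rw [hmap_hcomp, P.hcomp_smul] }
  map α :=
    { app := fun x => α.app (F.obj x)
      app_smul := fun f a => α.app_smul _ _ }

section Lan

variable (F : EnrichedFunctor SSet.{u} C D) (P : SPresheaf C)

/-- The `k`-simplices of the sum over `c` of `F_D(d, F c) × P c`. -/
structure LanPre (d : D) (k : SimplexCategoryᵒᵖ) : Type u where
  idx : C
  arr : (d ⟶[SSet.{u}] F.obj idx).obj k
  val : (P.obj idx).obj k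

/-- The two elements of the sum over `c` of `F_D(d, F c) × P c` induced by an element of
`F_D(d, F c) × F_C(c, c') × P c'`. -/
inductive LanRel (d : D) (k : SimplexCategoryᵒᵖ) : LanPre F P d k → LanPre F P d k → Prop
  | mk {c c' : C} (g : (d ⟶[SSet.{u}] F.obj c).obj k) (h : (c ⟶[SSet.{u}] c').obj k)
      (a : (P.obj c').obj k) :
      LanRel d k ⟨c', hcomp g (hmap F h), a⟩ ⟨c, g, P.smul h a⟩

variable {F P}

/-- The action of the simplicial operators. -/
def LanPre.whisker {d : D} {k k' : SimplexCategoryᵒᵖ} (β : k ⟶ k') (x : LanPre F P d k) :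
    LanPre F P d k' :=
  ⟨x.idx, (d ⟶[SSet.{u}] F.obj x.idx).map β x.arr, (P.obj x.idx).map β x.val⟩

/-- The action of the mapping spaces of `D` by precomposition. -/
def LanPre.precomp {d e : D} {k : SimplexCategoryᵒᵖ} (f : (d ⟶[SSet.{u}] e).obj k)
    (x : LanPre F P e k) : LanPre F P d k :=
  ⟨x.idx, hcomp f x.arr, x.val⟩

lemma LanRel.whisker {d : D} {k k' : SimplexCategoryᵒᵖ} (β : k ⟶ k') {x y : LanPre F P d k}
    (r : LanRel F P d k x y) : LanRel F P d k' (x.whisker β) (y.whisker β) := by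
  obtain ⟨g, h, a⟩ := r
  simp only [LanPre.whisker]
  rw [P.map_smul, map_hcomp, map_hmap]
  exact .mk _ _ _

lemma LanRel.precomp {d e : D} {k : SimplexCategoryᵒᵖ} (f : (d ⟶[SSet.{u}] e).obj k)
    {x y : LanPre F P e k} (r : LanRel F P e k x y) :
    LanRel F P d k (x.precomp f) (y.precomp f) := by
  obtain ⟨g, h, a⟩ := r
  simp only [LanPre.precomp]
  rw [← hcomp_assoc]
  exact .mk _ _ _

variable (F P)

/-- The left Kan extension of `P` along `F`: its value at `d` is the coequaliser of
`∑ F_D(d, F c) × F_C(c, c') × P c' ⇉ ∑ F_D(d, F c) × P c`. -/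
def lanObj : SPresheaf D where
  obj d :=
    { obj := fun k => Quot (LanRel F P d k)
      map := fun β => ↾Quot.map (LanPre.whisker β) (fun _ _ r => r.whisker β)
      map_id := fun k => by
        ext ⟨x⟩
        exact congrArg (Quot.mk _) (by simp [LanPre.whisker])
      map_comp := fun β γ => by
        ext ⟨x⟩
        exact congrArg (Quot.mk _) (by simp [LanPre.whisker]; exact ⟨rfl, rfl⟩) }
  smul f := Quot.map (LanPre.precomp f) (fun _ _ r => r.precomp f)
  map_smul β f := by
    rintro ⟨x⟩
    exact congrArg (fun g => Quot.mk _ (LanPre.mk x.idx g ((P.obj x.idx).map β x.val)))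
      (map_hcomp β f x.arr)
  id_smul := by
    rintro d k ⟨x⟩
    exact congrArg (Quot.mk _) (by simp [LanPre.precomp, hid_hcomp])
  hcomp_smul f g := by
    rintro ⟨x⟩
    exact congrArg (Quot.mk _) (by simp [LanPre.precomp, hcomp_assoc])

/-- The class of `(g, a)` in the left Kan extension. -/
def lanMk {c : C} {d : D} {k : SimplexCategoryᵒᵖ} (g : (d ⟶[SSet.{u}] F.obj c).obj k)
    (a : (P.obj c).obj k) : ((lanObj F P).obj d).obj k :=
  Quot.mk _ ⟨c, g, a⟩

lemma lanMk_smul {c c' : C} {d : D} {k : SimplexCategoryᵒᵖ}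
    (g : (d ⟶[SSet.{u}] F.obj c).obj k) (h : (c ⟶[SSet.{u}] c').obj k)
    (a : (P.obj c').obj k) :
    lanMk F P g (P.smul h a) = lanMk F P (hcomp g (hmap F h)) a :=
  (Quot.sound (.mk g h a)).symm

lemma smul_lanMk {c : C} {d e : D} {k : SimplexCategoryᵒᵖ} (f : (d ⟶[SSet.{u}] e).obj k)
    (g : (e ⟶[SSet.{u}] F.obj c).obj k) (a : (P.obj c).obj k) :
    (lanObj F P).smul f (lanMk F P g a) = lanMk F P (hcomp f g) a := rfl

lemma map_lanMk {c : C} {d : D} {k k' : SimplexCategoryᵒᵖ} (β : k ⟶ k')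
    (g : (d ⟶[SSet.{u}] F.obj c).obj k) (a : (P.obj c).obj k) :
    ((lanObj F P).obj d).map β (lanMk F P g a) =
      lanMk F P ((d ⟶[SSet.{u}] F.obj c).map β g) ((P.obj c).map β a) := rfl

/-- The unit `P ⟶ F^* F_! P`. -/
def lanUnit : P ⟶ (restrict F).obj (lanObj F P) where
  app c :=
    { app := fun k => ↾fun a => lanMk F P (hid (F.obj c) k) a
      naturality := fun k k' β => by
        ext a
        exact (congrArg (fun g => lanMk F P g ((P.obj c).map β a)) (map_hid _ β)).symm }
  app_smul {x y k} f a := by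
    refine (lanMk_smul F P _ f a).trans ?_
    refine Eq.trans ?_ (smul_lanMk F P (hmap F f) (hid (F.obj y) k) a).symm
    rw [hid_hcomp, hcomp_hid]

variable {F P}

/-- The transpose `F_! P ⟶ Q` of `φ : P ⟶ F^* Q`. -/
def lanDesc {Q : SPresheaf D} (φ : P ⟶ (restrict F).obj Q) : lanObj F P ⟶ Q where
  app d :=
    { app := fun k => ↾Quot.lift
        (fun x : LanPre F P d k => Q.smul x.arr ((φ.app x.idx).app k x.val)) (by
          rintro _ _ ⟨g, h, a⟩
          refine (Q.hcomp_smul _ _ _).trans ?_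
          exact congrArg (Q.smul g) (φ.app_smul h a).symm)
      naturality := fun k k' β => by
        ext ⟨x⟩
        refine Eq.trans ?_ (Q.map_smul β x.arr ((φ.app x.idx).app k x.val)).symm
        exact congrArg (Q.smul _) (NatTrans.naturality_apply (φ.app x.idx) β x.val) }
  app_smul f := by
    rintro ⟨x⟩
    exact Q.hcomp_smul _ _ _

variable (F)

/-- Left Kan extension `F_!` along a simplicial functor `F`. -/
def lan : SPresheaf C ⥤ SPresheaf D where
  obj P := lanObj F P
  map {P Q} α := lanDesc (α ≫ lanUnit F Q)
  map_id P := by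
    ext d k ⟨x⟩
    exact congrArg (fun g => lanMk F P g x.val) (hcomp_hid x.arr)
  map_comp {P Q R} α β := by
    ext d k ⟨x⟩
    refine congrArg (fun g => lanMk F R g ((β.app _).app k ((α.app _).app k x.val))) ?_
    exact congrArg (fun h => hcomp h (hid _ k)) (hcomp_hid x.arr).symm

/-- `F_!` is left adjoint to `F^*`. -/
def lanAdjunction : lan F ⊣ restrict F :=
  Adjunction.mkOfUnitCounit
    { unit :=
        { app := fun P => lanUnit F P
          naturality := fun P Q α => by
            ext c k a
            exact congrArg (fun g => lanMk F Q g ((α.app c).app k a)) (hid_hcomp _).symm }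
      counit :=
        { app := fun Q => lanDesc (𝟙 ((restrict F).obj Q))
          naturality := fun P Q α => by
            ext d k ⟨x⟩
            refine Eq.trans ?_ (α.app_smul x.arr x.val).symm
            refine (Q.hcomp_smul _ _ _).trans (congrArg (Q.smul x.arr) ?_)
            exact Q.id_smul _ }
      left_triangle := by
        ext P d k ⟨x⟩
        refine congrArg (fun g => lanMk F P g x.val) ?_
        exact (congrArg (fun h => hcomp h (hid _ k)) (hcomp_hid x.arr)).trans (hcomp_hid x.arr)
      right_triangle := by
        ext Q c k a
        exact Q.id_smul a }

end Lan

end SPresheaf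

/-! ### The join -/

/-- An `n`-simplex of the join `X * Y`: a monotone map `cut : [n] → [1]` together with maps of
simplicial sets to `X` and `Y` from the faces of `Δⁿ` spanned by `cut⁻¹ 0` and `cut⁻¹ 1`
respectively (each of these may be empty). -/
structure JoinSimplex (X Y : SSet.{u}) (n : SimplexCategory) : Type u where
  cut : n ⟶ .mk 1
  left (m : SimplexCategory) (g : m ⟶ n) (hg : g ≫ cut = SimplexCategory.const m (.mk 1) 0) :
    X.obj (op m)
  left_map {m m' : SimplexCategory} (α : m' ⟶ m) (g : m ⟶ n)
    (hg : g ≫ cut = SimplexCategory.const m (.mk 1) 0)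
    (hg' : (α ≫ g) ≫ cut = SimplexCategory.const m' (.mk 1) 0) :
    X.map α.op (left m g hg) = left m' (α ≫ g) hg'
  right (m : SimplexCategory) (g : m ⟶ n) (hg : g ≫ cut = SimplexCategory.const m (.mk 1) 1) :
    Y.obj (op m)
  right_map {m m' : SimplexCategory} (α : m' ⟶ m) (g : m ⟶ n)
    (hg : g ≫ cut = SimplexCategory.const m (.mk 1) 1)
    (hg' : (α ≫ g) ≫ cut = SimplexCategory.const m' (.mk 1) 1) :
    Y.map α.op (right m g hg) = right m' (α ≫ g) hg'

lemma JoinSimplex.ext {X Y : SSet.{u}} {n : SimplexCategory} {x y : JoinSimplex X Y n}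
    (hcut : x.cut = y.cut) (hleft : ∀ m g hg hg', x.left m g hg = y.left m g hg')
    (hright : ∀ m g hg hg', x.right m g hg = y.right m g hg') : x = y := by
  obtain ⟨c, l, _, r, _⟩ := x
  obtain ⟨c', l', _, r', _⟩ := y
  dsimp only at hcut
  subst hcut
  obtain rfl : l = l' := by
    funext m g hg
    exact hleft m g hg hg
  obtain rfl : r = r' := by
    funext m g hg
    exact hright m g hg hg
  rfl

lemma const_ne (m : SimplexCategory) :
    SimplexCategory.const m (.mk 1) 0 ≠ SimplexCategory.const m (.mk 1) 1 := fun h => by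
  have := congrArg (fun f => f.toOrderHom 0) h
  simp at this

/-- The action of the simplicial operators on the simplices of the join. -/
def JoinSimplex.pull {X Y : SSet.{u}} {n n' : SimplexCategory} (β : n' ⟶ n)
    (x : JoinSimplex X Y n) : JoinSimplex X Y n' where
  cut := β ≫ x.cut
  left m g hg := x.left m (g ≫ β) (by rw [Category.assoc, hg])
  left_map α g hg hg' := by
    simp only [Category.assoc]
    exact x.left_map _ _ _ _
  right m g hg := x.right m (g ≫ β) (by rw [Category.assoc, hg])
  right_map α g hg hg' := by
    simp only [Category.assoc]
    exact x.right_map _ _ _ _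

lemma JoinSimplex.pull_id {X Y : SSet.{u}} {n : SimplexCategory} (x : JoinSimplex X Y n) :
    x.pull (𝟙 n) = x := by
  refine JoinSimplex.ext (Category.id_comp _) (fun m g hg hg' => ?_) (fun m g hg hg' => ?_)
  all_goals
    simp only [pull, Category.comp_id]

/-- The simplex of the join given by a simplex of `X`. -/
def JoinSimplex.inl {X : SSet.{u}} (Y : SSet.{u}) {n : SimplexCategory} (x : X.obj (op n)) :
    JoinSimplex X Y n where
  cut := SimplexCategory.const _ _ 0
  left m g _ := X.map g.op x
  left_map α g _ _ := by rw [← Functor.map_comp_apply]; rfl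
  right m g hg := (const_ne m hg).elim
  right_map {m _} _ _ hg _ := (const_ne m hg).elim

/-- The simplex of the join given by a simplex of `Y`. -/
def JoinSimplex.inr (X : SSet.{u}) {Y : SSet.{u}} {n : SimplexCategory} (y : Y.obj (op n)) :
    JoinSimplex X Y n where
  cut := SimplexCategory.const _ _ 1
  left m g hg := (const_ne m hg.symm).elim
  left_map {m _} _ _ hg _ := (const_ne m hg.symm).elim
  right m g _ := Y.map g.op y
  right_map α g _ _ := by rw [← Functor.map_comp_apply]; rfl

/-- Functoriality of the simplices of the join. -/
def JoinSimplex.push {X X' Y Y' : SSet.{u}} (f : X ⟶ X') (g : Y ⟶ Y') {n : SimplexCategory}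
    (x : JoinSimplex X Y n) : JoinSimplex X' Y' n where
  cut := x.cut
  left m h hh := f.app _ (x.left m h hh)
  left_map α h hh hh' := by
    rw [← NatTrans.naturality_apply, x.left_map α h hh hh']
  right m h hh := g.app _ (x.right m h hh)
  right_map α h hh hh' := by
    rw [← NatTrans.naturality_apply, x.right_map α h hh hh']

/-- The join `X * Y`. -/
def join (X Y : SSet.{u}) : SSet.{u} where
  obj n := JoinSimplex X Y n.unop
  map β := ↾JoinSimplex.pull β.unop
  map_id n := by
    ext x
    exact x.pull_id
  map_comp β γ := by
    ext x
    exact JoinSimplex.ext rfl (fun _ _ _ _ => rfl) (fun _ _ _ _ => rfl)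

/-- The inclusion `X → X * Y`. -/
def joinInl (X Y : SSet.{u}) : X ⟶ join X Y where
  app n := ↾fun x => JoinSimplex.inl Y x
  naturality n n' β := by
    ext x
    exact JoinSimplex.ext rfl (fun m g _ _ => (Functor.map_comp_apply X β g.op x).symm)
      (fun m g hg _ => (const_ne m hg).elim)

/-- The inclusion `Y → X * Y`. -/
def joinInr (X Y : SSet.{u}) : Y ⟶ join X Y where
  app n := ↾fun y => JoinSimplex.inr X y
  naturality n n' β := by
    ext y
    exact JoinSimplex.ext rfl (fun m g hg _ => (const_ne m hg.symm).elim)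
      (fun m g _ _ => (Functor.map_comp_apply Y β g.op y).symm)

/-- Functoriality of the join. -/
def joinMap {X X' Y Y' : SSet.{u}} (f : X ⟶ X') (g : Y ⟶ Y') : join X Y ⟶ join X' Y' where
  app n := ↾fun x => JoinSimplex.push f g x
  naturality n n' β := by
    ext x
    exact JoinSimplex.ext rfl (fun _ _ _ _ => rfl) (fun _ _ _ _ => rfl)

lemma joinMap_id (X Y : SSet.{u}) : joinMap (𝟙 X) (𝟙 Y) = 𝟙 (join X Y) := by
  ext n x
  exact JoinSimplex.ext rfl (fun _ _ _ _ => rfl) (fun _ _ _ _ => rfl)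

lemma joinMap_comp {X X' X'' Y Y' Y'' : SSet.{u}} (f : X ⟶ X') (f' : X' ⟶ X'') (g : Y ⟶ Y')
    (g' : Y' ⟶ Y'') : joinMap f g ≫ joinMap f' g' = joinMap (f ≫ f') (g ≫ g') := by
  ext n x
  exact JoinSimplex.ext rfl (fun _ _ _ _ => rfl) (fun _ _ _ _ => rfl)

lemma joinInl_joinMap {X X' Y Y' : SSet.{u}} (f : X ⟶ X') (g : Y ⟶ Y') :
    joinInl X Y ≫ joinMap f g = f ≫ joinInl X' Y' := by
  ext n x
  exact JoinSimplex.ext rfl (fun m h _ _ => NatTrans.naturality_apply f h.op x)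
    (fun m h hh _ => (const_ne m hh).elim)

lemma joinInr_joinMap {X X' Y Y' : SSet.{u}} (f : X ⟶ X') (g : Y ⟶ Y') :
    joinInr X Y ≫ joinMap f g = g ≫ joinInr X' Y' := by
  ext n y
  exact JoinSimplex.ext rfl (fun m h hh _ => (const_ne m hh.symm).elim)
    (fun m h _ _ => NatTrans.naturality_apply g h.op y)

/-! ### Straightening -/

/-- The right cone `X * Δ⁰`. -/
abbrev cone (X : SSet.{u}) : SSet.{u} := join X (SSet.stdSimplex.obj (.mk 0))

/-- The inclusion `X → X * Δ⁰`. -/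
abbrev coneInl (X : SSet.{u}) : X ⟶ cone X := joinInl X _

/-- The map `v * id : X * Δ⁰ → X' * Δ⁰`. -/
abbrev coneMap {X X' : SSet.{u}} (v : X ⟶ X') : cone X ⟶ cone X' := joinMap v (𝟙 _)

/-- The vertex `*` of `X * Δ⁰`. -/
def coneVertex (X : SSet.{u}) : Vert (cone X) :=
  (joinInr X (SSet.stdSimplex.obj (.mk 0))).app _ (SSet.stdSimplex.objEquiv.symm (𝟙 _))

lemma coneMap_vertex {X X' : SSet.{u}} (v : X ⟶ X') :
    (coneMap v).app _ (coneVertex X) = coneVertex X' :=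
  congrArg (fun φ => φ.app (op (.mk 0)) (SSet.stdSimplex.objEquiv.symm (𝟙 _)))
    (joinInr_joinMap v (𝟙 (SSet.stdSimplex.obj (.mk 0))))

section Str

variable {X S X' S' X'' S'' : SSet.{u}}

/-- The simplicial set `S_p`, the pushout of `S` and `X * Δ⁰` along `X`. -/
noncomputable def glue (p : X ⟶ S) : SSet.{u} := pushout p (coneInl X)

/-- The map `S → S_p`. -/
noncomputable def glueInl (p : X ⟶ S) : S ⟶ glue p := pushout.inl p (coneInl X)

/-- The map `X * Δ⁰ → S_p`. -/
noncomputable def glueInr (p : X ⟶ S) : cone X ⟶ glue p := pushout.inr p (coneInl X)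

/-- The vertex `*` of `S_p`. -/
noncomputable def glueVertex (p : X ⟶ S) : Vert (glue p) := (glueInr p).app _ (coneVertex X)

/-- The map `S_p → S'_{p'}` induced by a commutative square. -/
noncomputable def glueMap {p : X ⟶ S} {p' : X' ⟶ S'} (v : X ⟶ X') (w : S ⟶ S')
    (h : p ≫ w = v ≫ p') : glue p ⟶ glue p' :=
  pushout.map p (coneInl X) p' (coneInl X') w (coneMap v) v h (joinInl_joinMap v (𝟙 _))

lemma glueInl_glueMap {p : X ⟶ S} {p' : X' ⟶ S'} (v : X ⟶ X') (w : S ⟶ S')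
    (h : p ≫ w = v ≫ p') : glueInl p ≫ glueMap v w h = w ≫ glueInl p' :=
  pushout.inl_desc _ _ _

lemma glueInr_glueMap {p : X ⟶ S} {p' : X' ⟶ S'} (v : X ⟶ X') (w : S ⟶ S')
    (h : p ≫ w = v ≫ p') : glueInr p ≫ glueMap v w h = coneMap v ≫ glueInr p' :=
  pushout.inr_desc _ _ _

lemma glue_hom_ext {p : X ⟶ S} {T : SSet.{u}} {f g : glue p ⟶ T}
    (h : glueInl p ≫ f = glueInl p ≫ g) (h' : glueInr p ≫ f = glueInr p ≫ g) : f = g :=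
  pushout.hom_ext h h'

lemma glueMap_inl_app {p : X ⟶ S} {p' : X' ⟶ S'} (v : X ⟶ X') (w : S ⟶ S')
    (h : p ≫ w = v ≫ p') (s : Vert S) (s' : Vert S') (hs : w.app _ s = s') :
    (glueMap v w h).app _ ((glueInl p).app _ s) = (glueInl p').app _ s' := by
  subst hs
  exact congrArg (fun φ => φ.app _ s) (glueInl_glueMap v w h)

lemma glueMap_vertex {p : X ⟶ S} {p' : X' ⟶ S'} (v : X ⟶ X') (w : S ⟶ S')
    (h : p ≫ w = v ≫ p') : (glueMap v w h).app _ (glueVertex p) = glueVertex p' :=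
  (congrArg (fun φ => φ.app _ (coneVertex X)) (glueInr_glueMap v w h)).trans
    (congrArg ((glueInr p').app _) (coneMap_vertex v))

lemma glueMap_id (p : X ⟶ S) (h : p ≫ 𝟙 S = 𝟙 X ≫ p) : glueMap (𝟙 X) (𝟙 S) h = 𝟙 (glue p) := by
  refine glue_hom_ext ?_ ?_
  · rw [glueInl_glueMap]; simp
  · rw [glueInr_glueMap, coneMap, joinMap_id]; simp

lemma glueMap_comp {p : X ⟶ S} {p' : X' ⟶ S'} {p'' : X'' ⟶ S''} (v : X ⟶ X') (w : S ⟶ S')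
    (h : p ≫ w = v ≫ p') (v' : X' ⟶ X'') (w' : S' ⟶ S'') (h' : p' ≫ w' = v' ≫ p'')
    (h'' : p ≫ w ≫ w' = (v ≫ v') ≫ p'') :
    glueMap v w h ≫ glueMap v' w' h' = glueMap (v ≫ v') (w ≫ w') h'' := by
  refine glue_hom_ext ?_ ?_
  · rw [glueInl_glueMap, ← Category.assoc, glueInl_glueMap, Category.assoc, glueInl_glueMap,
      Category.assoc]
  · rw [glueInr_glueMap, ← Category.assoc, glueInr_glueMap, Category.assoc, glueInr_glueMap,
      ← Category.assoc, joinMap_comp, Category.comp_id]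

/-- The straightening of `p : X → S`: the simplicial functor
`s ↦ F_{ℭ(S_p)}(s, *)` on `ℭ(S)ᵒᵖ`. -/
noncomputable def str (p : X ⟶ S) : SPresheaf (PathCat S) :=
  (SPresheaf.restrict (pathFunctor (glueInl p))).obj
    (SPresheaf.representable (⟨glueVertex p⟩ : PathCat (glue p)))

/-- The map `F_{ℭ(S_p)}(s, *) → F_{ℭ(S'_{p'})}(s', *)`, where `s' = w s`, induced by a
commutative square. -/
noncomputable def strMap {p : X ⟶ S} {p' : X' ⟶ S'} (v : X ⟶ X') (w : S ⟶ S')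
    (h : p ≫ w = v ≫ p') {s : PathCat S} {s' : PathCat S'} (hs : w.app _ s.as = s'.as) :
    (str p).obj s ⟶ (str p').obj s' :=
  pathMap (glueMap v w h) (glueMap_inl_app v w h s.as s'.as hs) (glueMap_vertex v w h)

lemma strMap_smul {p : X ⟶ S} {p' : X' ⟶ S'} (v : X ⟶ X') (w : S ⟶ S')
    (h : p ≫ w = v ≫ p') {s t : PathCat S} {s' t' : PathCat S'} (hs : w.app _ s.as = s'.as)
    (ht : w.app _ t.as = t'.as) {k : SimplexCategoryᵒᵖ} (f : (s ⟶[SSet.{u}] t).obj k)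
    (a : ((str p).obj t).obj k) :
    (strMap v w h hs).app k ((str p).smul f a) =
      (str p').smul (x := s') (y := t') ((pathMap w hs ht).app k f)
        ((strMap v w h ht).app k a) := by
  refine (pathMap_hcomp (glueMap v w h) (r := (pathFunctor (glueInl p)).obj s)
    (s := (pathFunctor (glueInl p)).obj t) (t := ⟨glueVertex p⟩)
    (r' := (pathFunctor (glueInl p')).obj s') (s' := (pathFunctor (glueInl p')).obj t')
    (t' := ⟨glueVertex p'⟩) (glueMap_inl_app v w h _ _ hs) (glueMap_inl_app v w h _ _ ht)
    (glueMap_vertex v w h) (hmap (pathFunctor (glueInl p)) f) a).trans ?_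
  have e : pathMap (glueInl p) rfl rfl ≫ pathMap (glueMap v w h)
      (glueMap_inl_app v w h _ _ hs) (glueMap_inl_app v w h _ _ ht) =
      pathMap w hs ht ≫ pathMap (glueInl p') rfl rfl :=
    (pathMap_comp _ _ _ (glueInl_glueMap v w h) _ _ _ _
      (congrArg ((glueInl p').app _) hs) (congrArg ((glueInl p').app _) ht)).trans
      (pathMap_comp _ _ _ rfl _ _ _ _ _ _).symm
  exact congrArg (fun φ => hcomp (x := (pathFunctor (glueInl p')).obj s')
    (y := (pathFunctor (glueInl p')).obj t') (z := ⟨glueVertex p'⟩) (φ.app k f)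
    ((strMap v w h ht).app k a)) e

lemma strMap_id (p : X ⟶ S) (s : PathCat S) :
    strMap (p := p) (p' := p) (𝟙 X) (𝟙 S) (by simp) (s := s) (s' := s) rfl = 𝟙 _ := by
  refine Eq.trans ?_ (pathMap_id _ _)
  unfold strMap
  congr 1
  exact glueMap_id p _

lemma strMap_comp {p : X ⟶ S} {p' : X' ⟶ S'} {p'' : X'' ⟶ S''} (v : X ⟶ X') (w : S ⟶ S')
    (h : p ≫ w = v ≫ p') (v' : X' ⟶ X'') (w' : S' ⟶ S'') (h' : p' ≫ w' = v' ≫ p'')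
    {v'' : X ⟶ X''} {w'' : S ⟶ S''} (h'' : p ≫ w'' = v'' ≫ p'')
    (hv : v ≫ v' = v'') (hw : w ≫ w' = w'')
    {s : PathCat S} {s' : PathCat S'} {s'' : PathCat S''} (hs : w.app _ s.as = s'.as)
    (hs' : w'.app _ s'.as = s''.as) (hs'' : w''.app _ s.as = s''.as) :
    strMap v w h hs ≫ strMap v' w' h' hs' = strMap v'' w'' h'' hs'' := by
  subst hv hw
  exact pathMap_comp _ _ _ (glueMap_comp v w h v' w' h' h'') _ _ _ _ _ _

end Str

/-- The straightening functor `Str : sSet/S ⥤ Fun(ℭ(S)ᵒᵖ, sSet)`. -/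
noncomputable def straightening (S : SSet.{u}) : Over S ⥤ SPresheaf (PathCat S) where
  obj p := str p.hom
  map {p p'} φ :=
    { app := fun s => strMap φ.left (𝟙 S) (by simp) (s := s) (s' := s) rfl
      app_smul := fun {s t k} f a => by
        refine (strMap_smul φ.left (𝟙 S) _ rfl rfl f a).trans ?_
        exact congrArg (fun g => (str p'.hom).smul g _)
          (congrArg (fun ψ => ψ.app k f) (pathMap_id s.as t.as)) }
  map_id p := by
    ext1 s
    exact strMap_id p.hom s
  map_comp φ ψ := by
    ext1 s
    exact (strMap_comp _ _ _ _ _ _ _ rfl (Category.id_comp _) rfl rfl rfl).symm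

/-- For `p : X ⟶ S`, the canonical maps
`Str(p')(x) = F_{ℭ(X_{p'})}(x, *) → F_{ℭ(S_{p' ≫ p})}(p x, *) = Str(p' ≫ p)(p x)`. -/
noncomputable def straighteningRestrict {X S : SSet.{u}} (p : X ⟶ S) :
    straightening X ⟶
      (Over.map p ⋙ straightening S) ⋙ SPresheaf.restrict (pathFunctor p) where
  app p' :=
    { app := fun x => strMap (p := p'.hom) (p' := p'.hom ≫ p) (𝟙 _) p (by simp)
        (s := x) (s' := (pathFunctor p).obj x) rfl
      app_smul := fun f a => strMap_smul (𝟙 _) p _ rfl rfl f a }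
  naturality p' p'' φ := by
    ext1 x
    refine (strMap_comp _ _ _ _ _ _ (v'' := φ.left) (w'' := p) (by simp)
      (Category.comp_id _) (Category.id_comp _) rfl rfl rfl).trans ?_
    exact (strMap_comp (p := p'.hom) (p' := p'.hom ≫ p) (p'' := p''.hom ≫ p) (𝟙 p'.left) p
      (by simp) φ.left (𝟙 S) (by simp) (by simp) (Category.id_comp _) (Category.comp_id _)
      (s := x) (s' := (pathFunctor p).obj x) (s'' := (pathFunctor p).obj x) rfl rfl rfl).symm

/-- The canonical natural transformation `ℭ(p)_! Str(p') → Str(p' ≫ p)` of functors of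
`p' : Y ⟶ X`, the transpose of `straighteningRestrict p` under the adjunction between left Kan
extension and restriction along `ℭ(p)`. -/
noncomputable def baseChange {X S : SSet.{u}} (p : X ⟶ S) :
    straightening X ⋙ SPresheaf.lan (pathFunctor p) ⟶ Over.map p ⋙ straightening S :=
  (((SPresheaf.lanAdjunction (pathFunctor p)).whiskerRight (Over X)).homEquiv _ _).symm
    (straighteningRestrict p)

end Straightening

/-! Colimits are preserved because `Str` has a right adjoint. Let the collage of a presheaf `Q` on
`ℭ(S)` be `ℭ(S)` with one extra object `⊤` whose incoming mapping spaces are the values of `Q`. A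
transformation `Str(p) → Q` amounts to a simplicial functor from `ℭ(S_p)` to this collage that
extends the inclusion of `ℭ(S)` and sends `*` to `⊤`. Since `ℭ` is left adjoint to the coherent
nerve and `S_p` is a pushout, such a functor is a map from `X * Δ⁰` to the nerve of the collage,
prescribed on `X` and on `*`. Over the cone on an `m`-simplex `y` of `X` it is a functor on the
thickening of `[m] ∪ {⊤}`. That thickening is itself the collage of the weight `i ↦ F(i, ⊤)` on
`ℭ[Δᵐ]`, so the datum at `y` is a transformation from the weight to the pullback of `Q` along `p y`.
Pairs of a simplex of `S` and such a transformation are the simplices of the unstraightening of `Q`,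
and the data for all `y` form a map over `S` from `X` to it.

In terms of elements, `Str(p)` is generated under the action of `ℭ(S)` by the elements `strGen p y
a`. Existence of a transformation with prescribed compatible values on them is `strDesc` with
`strDesc_strGen`; uniqueness is `str_hom_ext`. Uniqueness is first proved for functors
(`glue_functor_ext`) and carried to transformations by a functor from `ℭ(S_p)` to the collage of
`Str(p)` that has a left inverse.

Base change follows from the same description. Restricting `Q` along `ℭ(p)` does not alter its
values at the vertices of a simplex, so transformations from `Str(q)` to the restriction of `Q` and
from `Str(q ≫ p)` to `Q` are given by the same families on generators (`restrict_bijective`). The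
Yoneda lemma and the adjunction for left Kan extension conclude. -/

namespace Straightening

/-! ### The collage of a simplicial presheaf -/

section Collage

variable {C D : Type u} [EnrichedCategory SSet.{u} C] [EnrichedCategory SSet.{u} D]

/-- The objects of the collage of `P`: those of `C` and a new terminal vertex. -/
inductive Collage (P : SPresheaf C) : Type u
  | inl (c : C) : Collage P
  | top : Collage P

namespace Collage

variable {P : SPresheaf C}

/-- The mapping spaces of the collage. -/
def hom : Collage P → Collage P → SSet.{u}
  | inl c, inl d => c ⟶[SSet.{u}] d
  | inl c, top => P.obj c
  -- Nothing maps from `top` back to `C`, so every case below containing such an arrow is vacuous.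
  | top, inl _ => (Functor.const _).obj PEmpty
  | top, top => 𝟙_ SSet.{u}

/-- The identities of the collage. -/
def homId (k : SimplexCategoryᵒᵖ) : ∀ x : Collage P, (hom x x).obj k
  | inl c => hid c k
  | top => PUnit.unit

/-- The composition of the collage. -/
def homComp {k : SimplexCategoryᵒᵖ} : ∀ {x y z : Collage P}, (hom x y).obj k → (hom y z).obj k →
    (hom x z).obj k
  | inl _, inl _, inl _, f, g => hcomp f g
  | inl _, inl _, top, f, g => P.smul f g
  | inl _, top, top, f, _ => f
  | top, top, top, _, _ => PUnit.unit
  | _, top, inl _, _, g => PEmpty.elim g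
  | top, inl _, _, f, _ => PEmpty.elim f

lemma map_homId {k k' : SimplexCategoryᵒᵖ} (β : k ⟶ k') :
    ∀ x : Collage P, (hom x x).map β (homId k x) = homId k' x
  | inl c => map_hid c β
  | top => rfl

lemma map_homComp {k k' : SimplexCategoryᵒᵖ} (β : k ⟶ k') : ∀ {x y z : Collage P}
    (f : (hom x y).obj k) (g : (hom y z).obj k),
    (hom x z).map β (homComp f g) = homComp ((hom x y).map β f) ((hom y z).map β g)
  | inl _, inl _, inl _, f, g => map_hcomp β f g
  | inl _, inl _, top, f, g => P.map_smul β f g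
  | inl _, top, top, _, _ => rfl
  | top, top, top, _, _ => rfl
  | _, top, inl _, _, g => PEmpty.elim g
  | top, inl _, _, f, _ => PEmpty.elim f

lemma homId_homComp {k : SimplexCategoryᵒᵖ} : ∀ {x y : Collage P} (f : (hom x y).obj k),
    homComp (homId k x) f = f
  | inl _, inl _, f => hid_hcomp f
  | inl _, top, f => P.id_smul f
  | top, inl _, f => PEmpty.elim f
  | top, top, _ => rfl

lemma homComp_homId {k : SimplexCategoryᵒᵖ} : ∀ {x y : Collage P} (f : (hom x y).obj k),
    homComp f (homId k y) = f
  | inl _, inl _, f => hcomp_hid f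
  | inl _, top, _ => rfl
  | top, inl _, f => PEmpty.elim f
  | top, top, _ => rfl

/-- The one case that involves `P` nontrivially is two arrows of `C` followed by an element of `P`,
where associativity is the action axiom `hcomp_smul`. -/
lemma homComp_assoc {k : SimplexCategoryᵒᵖ} : ∀ {w x y z : Collage P} (f : (hom w x).obj k)
    (g : (hom x y).obj k) (h : (hom y z).obj k),
    homComp (homComp f g) h = homComp f (homComp g h)
  | inl _, inl _, inl _, inl _, f, g, h => hcomp_assoc f g h
  | inl _, inl _, inl _, top, f, g, h => P.hcomp_smul f g h
  | inl _, inl _, top, top, _, _, _ => rfl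
  | inl _, top, top, top, _, _, _ => rfl
  | top, top, top, top, _, _, _ => rfl
  | _, _, top, inl _, _, _, h => PEmpty.elim h
  | _, top, inl _, _, _, g, _ => PEmpty.elim g
  | top, inl _, _, _, f, _, _ => PEmpty.elim f

instance : EnrichedCategory SSet.{u} (Collage P) where
  Hom := hom
  id x :=
    { app := fun k => ↾fun _ => homId k x
      naturality := fun k k' β => by
        ext
        exact (map_homId β x).symm }
  comp x y z :=
    { app := fun k => ↾fun f => homComp f.1 f.2
      naturality := fun k k' β => by
        ext f
        exact (map_homComp β f.1 f.2).symm }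
  id_comp x y := by
    ext k f
    exact homId_homComp f
  comp_id x y := by
    ext k f
    exact homComp_homId f
  assoc w x y z := by
    ext k ⟨f, g, h⟩
    exact homComp_assoc f g h

/-- The functor from the collage of `P` determined by a functor `F`, an object `d` and a
transformation from `P` to `F_D(F(-), d)`. -/
def desc (F : EnrichedFunctor SSet.{u} C D) (d : D)
    (φ : P ⟶ (SPresheaf.restrict F).obj (SPresheaf.representable d)) :
    EnrichedFunctor SSet.{u} (Collage P) D where
  obj
    | inl c => F.obj c
    | top => d
  map
    | inl x, inl y => F.map x y
    | inl x, top => φ.app x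
    | top, inl _ =>
      { app := fun _ => ↾fun f => PEmpty.elim f
        naturality := fun _ _ _ => by
          ext f
          exact PEmpty.elim f }
    | top, top => eId SSet.{u} d
  map_id
    | inl x => F.map_id x
    | top => rfl
  map_comp
    | inl x, inl y, inl z => F.map_comp x y z
    -- Composition into `top` is the action on `P`, so functoriality here is naturality of `φ`.
    | inl x, inl y, top => by
      ext k ⟨f, g⟩
      exact φ.app_smul f g
    | inl x, top, top => by
      ext k ⟨f, g⟩
      exact (hcomp_hid (y := d) ((φ.app x).app k f)).symm
    | top, top, top => by
      ext k ⟨f, g⟩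
      exact (hcomp_hid (hid d k)).symm
    | _, top, inl _ => by
      ext k ⟨f, g⟩
      exact PEmpty.elim g
    | top, inl _, _ => by
      ext k ⟨f, g⟩
      exact PEmpty.elim f

variable (P) in
/-- The inclusion of `C` in the collage. -/
def incl : EnrichedFunctor SSet.{u} C (Collage P) where
  obj := inl
  map x y := 𝟙 _

end Collage

end Collage

/-! ### Simplices and functors of path categories -/

/-- A simplicial functor out of a path category is determined by its values on simplices. -/
lemma pathCat_functor_ext {S : SSet.{u}} {D : Type u} [EnrichedCategory SSet.{u} D]
    {Φ Ψ : EnrichedFunctor SSet.{u} (PathCat S) D}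
    (key : ∀ (m : SimplexCategory) (z : S.obj (op m)),
      (pathIota z).comp SSet.{u} Ψ = (pathIota z).comp SSet.{u} Φ) : Ψ = Φ := by
  -- A vertex is the only vertex of itself as a `0`-simplex, so agreement on `0`-simplices gives
  -- agreement on objects.
  have hv : ∀ s : Vert S, vertex s (⟨⟨0⟩⟩ : Thick.{u} (.mk 0)) = s := fun s => by
    unfold vertex
    rw [SimplexCategory.const_eq_id]
    simp
  have ho : ∀ s : PathCat S, Ψ.obj s = Φ.obj s := fun ⟨s⟩ => by
    have := congrArg (fun H => H.obj (⟨⟨0⟩⟩ : Thick.{u} (.mk 0))) (key _ s)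
    simpa [pathIota, hv] using this
  refine eFunctor_ext ho ?_
  rintro ⟨s⟩ ⟨t⟩ k f₀
  obtain ⟨f, rfl⟩ := Quot.exists_rep f₀
  revert f
  change ∀ f : PreHom S k s t, hcast (ho ⟨s⟩) (ho ⟨t⟩)
      (hmap Ψ (x := (⟨s⟩ : PathCat S)) (y := ⟨t⟩) (Quot.mk _ f)) =
    hmap Φ (x := (⟨s⟩ : PathCat S)) (y := ⟨t⟩) (Quot.mk _ f)
  intro f
  -- Every word is built from the generators `of`, where `key` applies, by identities and
  -- composition, which functors preserve.
  induction f with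
  | of m z i j a hs ht =>
    subst hs ht
    exact hcast_hmap (key m z) a
  | @id s t h =>
    subst h
    refine (congrArg (hcast _ _) (hmap_hid Ψ (⟨s⟩ : PathCat S) k)).trans ?_
    refine Eq.trans ?_ (hmap_hid Φ (⟨s⟩ : PathCat S) k).symm
    exact hcast_hid _ _ _
  | @comp r s t f g hf hg =>
    refine (congrArg (hcast _ _) (hmap_hcomp Ψ (x := (⟨r⟩ : PathCat S)) (y := ⟨s⟩) (z := ⟨t⟩)
      (Quot.mk _ f) (Quot.mk _ g))).trans ?_
    refine Eq.trans ?_ (hmap_hcomp Φ (x := (⟨r⟩ : PathCat S)) (y := ⟨s⟩) (z := ⟨t⟩)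
      (Quot.mk _ f) (Quot.mk _ g)).symm
    rw [← hf, ← hg]
    exact hcast_hcomp _ (ho ⟨s⟩) _ _ _

/-- A generator carries its endpoints as equations, so transport only changes these equations. -/
lemma hcast_of {S : SSet.{u}} {k : SimplexCategoryᵒᵖ} {s t s' t' : Vert S} (m : SimplexCategory)
    (z : S.obj (op m)) (i j : Thick.{u} m) (a : (i ⟶[SSet.{u}] j).obj k) (hs : vertex z i = s)
    (ht : vertex z j = t) (hs' : vertex z i = s') (ht' : vertex z j = t')
    (e : (⟨s⟩ : PathCat S) = ⟨s'⟩) (e' : (⟨t⟩ : PathCat S) = ⟨t'⟩) :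
    hcast (x := (⟨s⟩ : PathCat S)) (y := ⟨t⟩) (x' := ⟨s'⟩) (y' := ⟨t'⟩) e e' (k := k)
      (Quot.mk _ (.of m z i j a hs ht)) = Quot.mk _ (.of m z i j a hs' ht') := by
  subst hs ht hs' ht'
  rfl

/-- The simplices of a path category are compatible with simplicial operators. -/
lemma pathIota_map {S : SSet.{u}} {m m' : SimplexCategory} (α : m ⟶ m') (z : S.obj (op m')) :
    pathIota (S.map α.op z) = (Thick.map α).comp SSet.{u} (pathIota z) :=
  eFunctor_ext (fun i => congrArg PathCat.mk (vertex_map α z i)) fun i j _ a =>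
    (hcast_of m _ i j a rfl rfl (vertex_map α z i) (vertex_map α z j) _ _).trans
      (Quot.sound (.of_map α z i j a _ _))

/-- The simplices of a path category are compatible with maps of simplicial sets. -/
lemma pathIota_pathFunctor {S T : SSet.{u}} (f : S ⟶ T) {m : SimplexCategory}
    (z : S.obj (op m)) : (pathIota z).comp SSet.{u} (pathFunctor f) = pathIota (f.app _ z) :=
  eFunctor_ext (fun i => congrArg PathCat.mk (vertex_app f z i).symm) fun i j _ a =>
    hcast_of m (f.app _ z) i j a (vertex_app f z i) (vertex_app f z j) rfl rfl _ _

/-- Translates between endpoint equations built into `pathMap` and explicit transport. -/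
lemma pathMap_eq_hcast {S T : SSet.{u}} (f : S ⟶ T) {s t : PathCat S} {s' t' : PathCat T}
    (hs : f.app _ s.as = s'.as) (ht : f.app _ t.as = t'.as) {k : SimplexCategoryᵒᵖ}
    (x : (s ⟶[SSet.{u}] t).obj k) :
    (pathMap f hs ht).app k x = hcast (congrArg PathCat.mk hs) (congrArg PathCat.mk ht)
      (hmap (pathFunctor f) x) := by
  obtain ⟨s'⟩ := s'
  obtain ⟨t'⟩ := t'
  dsimp at hs ht
  subst hs ht
  rfl

/-! ### The coherent nerve -/

/-- The coherent nerve of a simplicial category. -/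
def cohNerve (D : Type u) [EnrichedCategory SSet.{u} D] : SSet.{u} where
  obj n := EnrichedFunctor SSet.{u} (Thick.{u} n.unop) D
  map α := ↾fun F => (Thick.map α.unop).comp SSet.{u} F
  map_id n := by
    ext F
    change EnrichedFunctor.comp SSet (SimplicialThickening.functor OrderHom.id) _ = _
    rw [SimplicialThickening.functor_id]
    rfl
  map_comp f g := by
    ext F
    change EnrichedFunctor.comp SSet (SimplicialThickening.functor
      (f.unop.toOrderHom.uliftMap.comp g.unop.toOrderHom.uliftMap)) _ = _
    rw [SimplicialThickening.functor_comp]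
    rfl

/-- The functor `ℭ(S) → D` corresponding to a map `S → N(D)`. -/
def nerveTranspose {S : SSet.{u}} {D : Type u} [EnrichedCategory SSet.{u} D]
    (φ : S ⟶ cohNerve D) : EnrichedFunctor SSet.{u} (PathCat S) D :=
  pathDesc (E := fun m z => φ.app (op m) z) fun _ _ α z => NatTrans.naturality_apply φ α.op z

lemma pathIota_nerveTranspose {S : SSet.{u}} {D : Type u} [EnrichedCategory SSet.{u} D]
    (φ : S ⟶ cohNerve D) {m : SimplexCategory} (z : S.obj (op m)) :
    (pathIota z).comp SSet.{u} (nerveTranspose φ) = φ.app (op m) z :=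
  pathIota_pathDesc _ z

/-- The map `S → N(D)` corresponding to a functor `ℭ(S) → D`. -/
def toNerve {S : SSet.{u}} {D : Type u} [EnrichedCategory SSet.{u} D]
    (Φ : EnrichedFunctor SSet.{u} (PathCat S) D) : S ⟶ cohNerve D where
  app m := ↾fun z => (pathIota (m := m.unop) z).comp SSet.{u} Φ
  naturality m m' α := by
    ext z
    exact congrArg (fun F => EnrichedFunctor.comp SSet.{u} F Φ) (pathIota_map α.unop z)

lemma eFunctor_assoc {A B C D : Type u} [EnrichedCategory SSet.{u} A] [EnrichedCategory SSet.{u} B]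
    [EnrichedCategory SSet.{u} C] [EnrichedCategory SSet.{u} D] (F : EnrichedFunctor SSet.{u} A B)
    (G : EnrichedFunctor SSet.{u} B C) (H : EnrichedFunctor SSet.{u} C D) :
    (F.comp SSet.{u} G).comp SSet.{u} H = F.comp SSet.{u} (G.comp SSet.{u} H) :=
  eFunctor_ext (fun _ => rfl) fun _ _ _ _ => rfl

/-! ### The simplicial thickening of a cone -/

section ConeThickening

variable (J : Type u) [LinearOrder J]

/-- The inclusion of `J` in `J ∪ {⊤}`. -/
def coeTop : J →o WithTop J := ⟨WithTop.some, WithTop.coe_mono⟩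

/-- The inclusion of the thickening of `J` in that of `J ∪ {⊤}`. -/
abbrev thickIncl :
    EnrichedFunctor SSet.{u} (SimplicialThickening J) (SimplicialThickening (WithTop J)) :=
  SimplicialThickening.functor (coeTop J)

/-- The simplicial presheaf `j ↦ F(j, ⊤)` on the thickening of `J`. -/
abbrev coneWeight : SPresheaf (SimplicialThickening J) :=
  (SPresheaf.restrict (thickIncl J)).obj (SPresheaf.representable ⟨⊤⟩)

variable {J}

/-- The restriction to `J` of paths in `J ∪ {⊤}`. -/
def pathRestrict (i j : SimplicialThickening J) :
    ((thickIncl J).obj i ⟶ (thickIncl J).obj j) ⥤ (i ⟶ j) where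
  obj I :=
    { I := WithTop.some ⁻¹' I.I
      left := I.left
      right := I.right
      left_le := fun k hk => WithTop.coe_le_coe.1 (I.left_le _ hk)
      le_right := fun k hk => WithTop.coe_le_coe.1 (I.le_right _ hk) }
  map f := ⟨⟨⟨Set.preimage_mono f.1.1.1⟩⟩⟩

lemma functorMap_pathRestrict (i j : SimplicialThickening J) :
    SimplicialThickening.functorMap (coeTop J) i j ⋙ pathRestrict i j = 𝟭 _ :=
  CategoryTheory.Functor.ext (fun I => SimplicialThickening.hom_ext _ _ _ _ fun t => by
    change WithTop.some t ∈ WithTop.some '' I.I ↔ t ∈ I.I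
    simp) (by cat_disch)

/-- A path ending at a point of `J` is bounded by it, hence misses `⊤` and is the image of its trace
on `J`. -/
lemma pathRestrict_functorMap (i j : SimplicialThickening J) :
    pathRestrict i j ⋙ SimplicialThickening.functorMap (coeTop J) i j = 𝟭 _ :=
  CategoryTheory.Functor.ext (fun I => SimplicialThickening.hom_ext _ _ _ _ fun t => by
    change t ∈ WithTop.some '' (WithTop.some ⁻¹' I.I) ↔ t ∈ I.I
    refine ⟨?_, fun ht => ?_⟩
    · rintro ⟨x, hx, rfl⟩
      exact hx
    · obtain ⟨x, rfl⟩ := WithTop.ne_top_iff_exists.1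
        ((I.le_right t ht).trans_lt (WithTop.coe_lt_top j.as)).ne
      exact ⟨x, ht, rfl⟩) (by cat_disch)

/-- The restriction to `J` of simplices of the mapping spaces of the thickening of `J ∪ {⊤}`. -/
def hrestrict {i j : SimplicialThickening J} {k : SimplexCategoryᵒᵖ}
    (f : ((thickIncl J).obj i ⟶[SSet.{u}] (thickIncl J).obj j).obj k) :
    (i ⟶[SSet.{u}] j).obj k :=
  (nerveMap (pathRestrict i j)).app k f

/-- Together with `hmap_hrestrict` this makes `thickIncl J` fully faithful in the simplicial sense.
-/
lemma hrestrict_hmap {i j : SimplicialThickening J} {k : SimplexCategoryᵒᵖ}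
    (f : (i ⟶[SSet.{u}] j).obj k) : hrestrict (hmap (thickIncl J) f) = f :=
  congrArg (fun G => (nerveMap G).app k f) (functorMap_pathRestrict i j)

lemma hmap_hrestrict {i j : SimplicialThickening J} {k : SimplexCategoryᵒᵖ}
    (f : ((thickIncl J).obj i ⟶[SSet.{u}] (thickIncl J).obj j).obj k) :
    hmap (thickIncl J) (hrestrict f) = f :=
  congrArg (fun G => (nerveMap G).app k f) (pathRestrict_functorMap i j)

lemma hmap_thickIncl_injective {i j : SimplicialThickening J} {k : SimplexCategoryᵒᵖ} :
    Function.Injective (hmap (thickIncl J) (x := i) (y := j) (k := k)) := fun f g h => by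
  rw [← hrestrict_hmap f, h, hrestrict_hmap]

/-- Any vertex of a simplex of the mapping space is a path from `i` to `j`, which forces `i ≤ j`. -/
lemma isEmpty_hom_of_lt {K : Type u} [LinearOrder K] {i j : SimplicialThickening K}
    (h : j.as < i.as) (k : SimplexCategoryᵒᵖ) : IsEmpty ((i ⟶[SSet.{u}] j).obj k) :=
  ⟨fun f => (SimplicialThickening.Path.le (ComposableArrows.obj' f 0)).not_gt h⟩

/-- The only path from `i` to `i` is `{i}`, so this mapping space is a point. -/
lemma hom_self_eq {K : Type u} [LinearOrder K] {i : SimplicialThickening K}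
    {k : SimplexCategoryᵒᵖ} (f : (i ⟶[SSet.{u}] i).obj k) : f = hid i k :=
  CategoryTheory.Functor.ext (fun x => SimplicialThickening.hom_ext _ _ _ _ fun t => by
    change t ∈ (f.obj x).I ↔ t = i.as
    refine ⟨fun ht => le_antisymm ((f.obj x).le_right t ht) ((f.obj x).left_le t ht), ?_⟩
    rintro rfl
    exact (f.obj x).left) (by cat_disch)

/-- Functors from the thickening of `J ∪ {⊤}` are determined by their restrictions to that of `J`
and to the mapping spaces to `⊤`. -/
lemma thickTop_functor_ext {D : Type u} [EnrichedCategory SSet.{u} D]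
    {F G : EnrichedFunctor SSet.{u} (SimplicialThickening (WithTop J)) D}
    (h : (thickIncl J).comp SSet.{u} F = (thickIncl J).comp SSet.{u} G)
    (ht : F.obj ⟨⊤⟩ = G.obj ⟨⊤⟩)
    (hφ : ∀ (i : SimplicialThickening J) (k : SimplexCategoryᵒᵖ)
      (a : ((coneWeight J).obj i).obj k),
      hcast (congrArg (fun H => H.obj i) h) ht (hmap F a) = hmap G a) : F = G := by
  refine eFunctor_ext
    (fun x => match x with
      | ⟨some i⟩ => congrArg (fun H => H.obj ⟨i⟩) h
      | ⟨none⟩ => ht) ?_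
  -- The four cases: `⊤ → ⊤` is a point, `⊤ → j` is empty, `i → ⊤` is the hypothesis `hφ`, and `i →
  -- j` comes from `J` by fullness.
  rintro ⟨(_ | i)⟩ ⟨(_ | j)⟩ k f
  · obtain rfl := hom_self_eq f
    refine (congrArg (hcast _ _) (hmap_hid F _ k)).trans ?_
    exact (hcast_hid _ _ _).trans (hmap_hid G _ k).symm
  · exact ((isEmpty_hom_of_lt (WithTop.coe_lt_top j) k).false f).elim
  · exact hφ ⟨i⟩ k f
  · obtain ⟨f, rfl⟩ : ∃ g : ((⟨i⟩ : SimplicialThickening J) ⟶[SSet.{u}] ⟨j⟩).obj k,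
      hmap (thickIncl J) g = f := ⟨_, hmap_hrestrict (i := ⟨i⟩) (j := ⟨j⟩) f⟩
    exact hcast_hmap h f

variable (J) in
/-- The thickening of `J ∪ {⊤}` as a collage. -/
def thickCollage :
    EnrichedFunctor SSet.{u} (SimplicialThickening (WithTop J)) (Collage (coneWeight J)) where
  obj
    | ⟨some i⟩ => .inl ⟨i⟩
    | ⟨none⟩ => .top
  map
    | ⟨some i⟩, ⟨some j⟩ => nerveMap (pathRestrict ⟨i⟩ ⟨j⟩)
    | ⟨some i⟩, ⟨none⟩ => 𝟙 _
    | ⟨none⟩, ⟨some j⟩ =>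
      { app := fun k => ↾fun f => ((isEmpty_hom_of_lt (WithTop.coe_lt_top j) k).false f).elim
        naturality := fun k k' β => by
          ext f
          exact ((isEmpty_hom_of_lt (WithTop.coe_lt_top j) k).false f).elim }
    | ⟨none⟩, ⟨none⟩ =>
      { app := fun _ => ↾fun _ => PUnit.unit }
  map_id
    | ⟨some i⟩ => by
      ext k ⟨⟩
      exact (congrArg hrestrict (hmap_hid (thickIncl J) ⟨i⟩ k)).symm.trans (hrestrict_hmap _)
    | ⟨none⟩ => rfl
  map_comp
    | ⟨some i⟩, ⟨some j⟩, ⟨some l⟩ => by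
      ext k ⟨f, g⟩
      -- Restriction is inverse to `hmap (thickIncl J)`, so compatibility with composition may be
      -- tested after including back, where it is functoriality of `thickIncl J`.
      refine hmap_thickIncl_injective (i := ⟨i⟩) (j := ⟨l⟩) ?_
      refine (hmap_hrestrict (i := ⟨i⟩) (j := ⟨l⟩) (hcomp f g)).trans ?_
      refine Eq.trans ?_ (hmap_hcomp (thickIncl J) (hrestrict (i := ⟨i⟩) (j := ⟨j⟩) f)
        (hrestrict (i := ⟨j⟩) (j := ⟨l⟩) g)).symm
      exact congrArg₂ hcomp (hmap_hrestrict (i := ⟨i⟩) (j := ⟨j⟩) f).symm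
        (hmap_hrestrict (i := ⟨j⟩) (j := ⟨l⟩) g).symm
    | ⟨some i⟩, ⟨some j⟩, ⟨none⟩ => by
      ext k ⟨f, g⟩
      exact congrArg (fun h => hcomp h g) (hmap_hrestrict (i := ⟨i⟩) (j := ⟨j⟩) f).symm
    | ⟨some i⟩, ⟨none⟩, ⟨none⟩ => by
      ext k ⟨f, g⟩
      obtain rfl := hom_self_eq g
      exact hcomp_hid f
    | ⟨none⟩, ⟨none⟩, ⟨none⟩ => rfl
    | _, ⟨none⟩, ⟨some j⟩ => by
      ext k ⟨f, g⟩
      exact ((isEmpty_hom_of_lt (WithTop.coe_lt_top j) k).false g).elim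
    | ⟨none⟩, ⟨some i⟩, _ => by
      ext k ⟨f, g⟩
      exact ((isEmpty_hom_of_lt (WithTop.coe_lt_top i) k).false f).elim

lemma thickIncl_thickCollage :
    (thickIncl J).comp SSet.{u} (thickCollage J) = Collage.incl (coneWeight J) :=
  eFunctor_ext (fun _ => rfl) fun _ _ _ f => hrestrict_hmap f

end ConeThickening

/-! ### Unstraightening -/

/-- The simplicial presheaf `i ↦ F(i, ⊤)` on `ℭ[Δᵐ]`. -/
abbrev thickWeight (m : SimplexCategory) : SPresheaf (Thick.{u} m) :=
  coneWeight (ULift.{u} (Fin (m.len + 1)))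

/-- The extension of a simplicial operator to the cones. -/
abbrev opTop {m m' : SimplexCategory} (α : m ⟶ m') :
    WithTop (ULift.{u} (Fin (m.len + 1))) →o WithTop (ULift.{u} (Fin (m'.len + 1))) :=
  α.toOrderHom.uliftMap.withTopMap

/-- The functoriality of the thickenings of the cones. -/
abbrev thickTopMap {m m' : SimplexCategory} (α : m ⟶ m') :=
  SimplicialThickening.functor (opTop.{u} α)

/-- The functoriality of the weights `thickWeight`. -/
def weightMap {m m' : SimplexCategory} (α : m ⟶ m') {i : Thick.{u} m} {k : SimplexCategoryᵒᵖ}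
    (a : ((thickWeight m).obj i).obj k) : ((thickWeight m').obj ((Thick.map α).obj i)).obj k :=
  hmap (thickTopMap α) a

lemma thickIncl_thickTopMap {m m' : SimplexCategory} (α : m ⟶ m') :
    (thickIncl _).comp SSet.{u} (thickTopMap.{u} α) = (Thick.map α).comp SSet.{u} (thickIncl _) :=
  (SimplicialThickening.functor_comp _ _).symm.trans
    (SimplicialThickening.functor_comp α.toOrderHom.uliftMap (coeTop _))

lemma thickTopMap_id (m : SimplexCategory) :
    thickTopMap.{u} (𝟙 m) = EnrichedFunctor.id SSet.{u} _ := by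
  have : opTop.{u} (𝟙 m) = OrderHom.id := by
    ext1
    funext x
    cases x <;> rfl
  rw [thickTopMap, this, SimplicialThickening.functor_id]

lemma thickTopMap_comp {m m' m'' : SimplexCategory} (α : m ⟶ m') (β : m' ⟶ m'') :
    thickTopMap.{u} (α ≫ β) = (thickTopMap α).comp SSet.{u} (thickTopMap β) := by
  have : opTop.{u} (α ≫ β) = (opTop β).comp (opTop α) := by
    ext1
    funext x
    cases x <;> rfl
  rw [thickTopMap, this, SimplicialThickening.functor_comp]

lemma weightMap_smul {m m' : SimplexCategory} (α : m ⟶ m') {i j : Thick.{u} m}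
    {k : SimplexCategoryᵒᵖ} (f : (i ⟶[SSet.{u}] j).obj k) (a : ((thickWeight m).obj j).obj k) :
    weightMap α ((thickWeight m).smul f a) =
      (thickWeight m').smul (hmap (Thick.map α) f) (weightMap α a) :=
  (hmap_hcomp (thickTopMap α) (hmap (thickIncl _) f) a).trans
    (congrArg (fun g => hcomp g (weightMap α a))
      (hcast_hmap (thickIncl_thickTopMap α) f))

variable {S : SSet.{u}}

/-- The simplex of a mapping space of `ℭ(S)` given by a simplex `z` of `S` and a simplex of a
mapping space of `ℭ[Δᵐ]`. -/
def pathOf {m : SimplexCategory} (z : S.obj (op m)) {i j : Thick.{u} m} {k : SimplexCategoryᵒᵖ}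
    (f : (i ⟶[SSet.{u}] j).obj k) {s t : Vert S} (hs : vertex z i = s) (ht : vertex z j = t) :
    ((⟨s⟩ : PathCat S) ⟶[SSet.{u}] ⟨t⟩).obj k :=
  Quot.mk _ (.of m z i j f hs ht)

lemma pathOf_map {m m' : SimplexCategory} (α : m ⟶ m') (z : S.obj (op m')) {i j : Thick.{u} m}
    {k : SimplexCategoryᵒᵖ} (f : (i ⟶[SSet.{u}] j).obj k) {s t : Vert S}
    (hs : vertex (S.map α.op z) i = s) (ht : vertex (S.map α.op z) j = t) :
    pathOf (S.map α.op z) f hs ht = pathOf z (hmap (Thick.map α) f)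
      ((vertex_map α z i).symm.trans hs) ((vertex_map α z j).symm.trans ht) :=
  Quot.sound (.of_map α z i j f hs ht)

/-- An `m`-simplex of the unstraightening of `Q`: an `m`-simplex `pt` of `S` and a transformation
from `thickWeight m` to the restriction of `Q` along `pt`. -/
structure UnSimplex (Q : SPresheaf (PathCat S)) (m : SimplexCategory) : Type u where
  pt : S.obj (op m)
  -- The object `s` is a variable with an equation, because the vertices of a pulled back simplex
  -- agree with those of the original only up to a proved equality; this avoids transport in `pull`.
  val {k : SimplexCategoryᵒᵖ} {i : Thick.{u} m} (a : ((thickWeight m).obj i).obj k) (s : Vert S)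
    (hs : vertex pt i = s) : (Q.obj ⟨s⟩).obj k
  map_val {k k' : SimplexCategoryᵒᵖ} (β : k ⟶ k') {i : Thick.{u} m}
    (a : ((thickWeight m).obj i).obj k) (s : Vert S) (hs : vertex pt i = s) :
    (Q.obj ⟨s⟩).map β (val a s hs) = val (((thickWeight m).obj i).map β a) s hs
  val_smul {k : SimplexCategoryᵒᵖ} {i j : Thick.{u} m} (f : (i ⟶[SSet.{u}] j).obj k)
    (a : ((thickWeight m).obj j).obj k) (s t : Vert S) (hs : vertex pt i = s)
    (ht : vertex pt j = t) :
    val ((thickWeight m).smul f a) s hs = Q.smul (pathOf pt f hs ht) (val a t ht)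

namespace UnSimplex

variable {Q : SPresheaf (PathCat S)}

lemma ext {m : SimplexCategory} {u v : UnSimplex Q m} (h : u.pt = v.pt)
    (h' : ∀ (k : SimplexCategoryᵒᵖ) (i : Thick.{u} m) (a : ((thickWeight m).obj i).obj k)
      (s : Vert S) (hs : vertex u.pt i = s) (hs' : vertex v.pt i = s),
      u.val a s hs = v.val a s hs') : u = v := by
  obtain ⟨p, f, _, _⟩ := u
  obtain ⟨q, g, _, _⟩ := v
  dsimp only at h
  subst h
  obtain rfl : @f = @g := by
    funext k i a s hs
    exact h' k i a s hs hs
  rfl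

/-- The action of the simplicial operators. -/
def pull {m m' : SimplexCategory} (α : m ⟶ m') (u : UnSimplex Q m') : UnSimplex Q m where
  pt := S.map α.op u.pt
  val a s hs := u.val (weightMap α a) s ((vertex_map α _ _).symm.trans hs)
  map_val β i a s hs := (u.map_val β _ _ _).trans (congrArg (fun b => u.val b s _)
    (map_hmap (thickTopMap α) β a))
  val_smul f a s t hs ht := by
    rw [pathOf_map]
    exact (congrArg (fun b => u.val b s _) (weightMap_smul α f a)).trans
      (u.val_smul _ _ _ _ _ _)

/-- The transformation given by a simplex of the unstraightening, with values in the mapping spaces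
of the collage of `Q`. -/
def transform {m : SimplexCategory} (u : UnSimplex Q m) :
    thickWeight m ⟶ (SPresheaf.restrict ((pathIota u.pt).comp SSet.{u} (Collage.incl Q))).obj
      (SPresheaf.representable Collage.top) where
  app i :=
    { app := fun k => ↾fun a => u.val a _ rfl
      naturality := fun k k' β => by
        ext a
        exact (u.map_val β a _ rfl).symm }
  app_smul f a := u.val_smul f a _ _ rfl rfl

/-- The functor from the thickening of the cone to the collage of `Q` given by a simplex of the
unstraightening. -/
def toFunctor {m : SimplexCategory} (u : UnSimplex Q m) :
    EnrichedFunctor SSet.{u} (SimplicialThickening (WithTop (ULift.{u} (Fin (m.len + 1)))))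
      (Collage Q) :=
  (thickCollage _).comp SSet.{u} (Collage.desc _ Collage.top u.transform)

lemma thickIncl_toFunctor {m : SimplexCategory} (u : UnSimplex Q m) :
    (thickIncl _).comp SSet.{u} u.toFunctor =
      (pathIota u.pt).comp SSet.{u} (Collage.incl Q) := by
  rw [toFunctor, ← eFunctor_assoc, thickIncl_thickCollage]
  exact eFunctor_ext (fun _ => rfl) fun _ _ _ _ => rfl

lemma hcast_val {m : SimplexCategory} (u : UnSimplex Q m) {k : SimplexCategoryᵒᵖ}
    {i : Thick.{u} m} (a : ((thickWeight m).obj i).obj k) {s t : Vert S} (hs : vertex u.pt i = s)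
    (ht : vertex u.pt i = t) (e : (Collage.inl ⟨s⟩ : Collage Q) = .inl ⟨t⟩) :
    hcast (D := Collage Q) (x := .inl ⟨s⟩) (y := .top) e rfl (u.val a s hs) = u.val a t ht := by
  subst hs ht
  rfl

/-- By `thickTop_functor_ext` it suffices to compare on `[m]`, where this is `pathIota_map`, and on
arrows to `⊤`, where `pull` is evaluation at `weightMap α a`. It makes the functors attached to the
simplices of `X` a compatible family. -/
lemma pull_toFunctor {m m' : SimplexCategory} (α : m ⟶ m') (u : UnSimplex Q m') :
    (u.pull α).toFunctor = (thickTopMap α).comp SSet.{u} u.toFunctor := by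
  refine thickTop_functor_ext ?_ rfl fun i k a => ?_
  · rw [thickIncl_toFunctor, ← eFunctor_assoc, thickIncl_thickTopMap, eFunctor_assoc,
      thickIncl_toFunctor, ← eFunctor_assoc]
    exact congrArg (fun F => EnrichedFunctor.comp SSet.{u} F (Collage.incl Q)) (pathIota_map α _)
  · exact hcast_val u (weightMap α a) _ _ _

end UnSimplex

/-- The total space of the unstraightening of `Q`. -/
def unTotal (Q : SPresheaf (PathCat S)) : SSet.{u} where
  obj m := UnSimplex Q m.unop
  map α := ↾UnSimplex.pull α.unop
  map_id m := by
    ext u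
    change UnSimplex.pull (𝟙 m.unop) u = u
    refine UnSimplex.ext (by
      change S.map (𝟙 (op m.unop)) u.pt = u.pt
      simp) fun k i a s hs hs' => ?_
    exact congrArg (fun b => u.val b s hs') (hcast_hmap (thickTopMap_id m.unop) a)
  map_comp α β := by
    ext u
    change UnSimplex.pull (β.unop ≫ α.unop) u = UnSimplex.pull β.unop (UnSimplex.pull α.unop u)
    refine UnSimplex.ext (by
      change S.map (α.unop.op ≫ β.unop.op) u.pt = S.map β.unop.op (S.map α.unop.op u.pt)
      simp) fun k i a s hs hs' => ?_
    exact congrArg (fun b => u.val b s _) (hcast_hmap (thickTopMap_comp β.unop α.unop) a)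

/-- The unstraightening of `Q`. -/
def unstraighten (Q : SPresheaf (PathCat S)) : Over S :=
  Over.mk (Y := unTotal Q) { app := fun m => ↾UnSimplex.pt }

/-! ### Simplices of the cone -/

section ConeSimplex

variable {X : SSet.{u}}

/-- The component in `Δ⁰` carries no information. -/
lemma cone_ext {n : SimplexCategory} {x y : JoinSimplex X (SSet.stdSimplex.{u}.obj (.mk 0)) n}
    (hcut : x.cut = y.cut) (hleft : ∀ m g hg hg', x.left m g hg = y.left m g hg') : x = y :=
  JoinSimplex.ext hcut hleft fun _ _ _ _ =>
    SSet.stdSimplex.objEquiv.injective (by ext; simp)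

lemma JoinSimplex.left_congr {Y : SSet.{u}} {n : SimplexCategory} (x : JoinSimplex X Y n)
    {m : SimplexCategory} {g g' : m ⟶ n} (h : g = g')
    (hg : g ≫ x.cut = SimplexCategory.const m (.mk 1) 0)
    (hg' : g' ≫ x.cut = SimplexCategory.const m (.mk 1) 0) : x.left m g hg = x.left m g' hg' := by
  subst h
  rfl

/-- Monotone maps to the cone on a simplex. -/
abbrev TopMap (n m : SimplexCategory) : Type u :=
  ULift.{u} (Fin (n.len + 1)) →o WithTop (ULift.{u} (Fin (m.len + 1)))

namespace TopMap

variable {n m : SimplexCategory} (γ : TopMap.{u} n m)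

/-- The cut of `[n]` into the preimages of `[m]` and `⊤`. -/
noncomputable def cut : n ⟶ .mk 1 :=
  SimplexCategory.Hom.mk
    { toFun := fun i => open Classical in if γ ⟨i⟩ = ⊤ then 1 else 0
      monotone' := fun i j h => by
        have hγ : γ ⟨i⟩ ≤ γ ⟨j⟩ := γ.monotone (ULift.up_le.2 h)
        dsimp only
        split_ifs with h₁ h₂
        · exact le_rfl
        · exact (h₂ (top_le_iff.1 (h₁ ▸ hγ))).elim
        · exact Fin.zero_le _
        · exact le_rfl }

lemma cut_eq_zero_iff (i : Fin (n.len + 1)) : γ.cut.toOrderHom i = 0 ↔ γ ⟨i⟩ ≠ ⊤ := by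
  change (open Classical in if γ ⟨i⟩ = ⊤ then (1 : Fin 2) else 0) = 0 ↔ _
  split_ifs with h <;> simp [h]

lemma comp_eq_const_iff {m' : SimplexCategory} (g : m' ⟶ n) (c : n ⟶ .mk 1) :
    g ≫ c = SimplexCategory.const m' (.mk 1) 0 ↔
      ∀ i, c.toOrderHom (g.toOrderHom i) = 0 := by
  refine ⟨fun h i => congrArg (fun f => f.toOrderHom i) h, fun h => ?_⟩
  ext i : 3
  exact h i

/-- The operator through which `γ` acts on a face that it does not map to `⊤`. -/
def lower {m' : SimplexCategory} (g : m' ⟶ n) (h : ∀ i, γ ⟨g.toOrderHom i⟩ ≠ ⊤) : m' ⟶ m :=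
  SimplexCategory.Hom.mk
    { toFun := fun i => ((γ ⟨g.toOrderHom i⟩).untop (h i)).down
      monotone' := fun i j hij => by
        have : γ ⟨g.toOrderHom i⟩ ≤ γ ⟨g.toOrderHom j⟩ :=
          γ.monotone (ULift.up_le.2 (g.toOrderHom.monotone hij))
        rw [← WithTop.coe_untop _ (h i), ← WithTop.coe_untop _ (h j)] at this
        exact ULift.down_le.2 (WithTop.coe_le_coe.1 this) }

lemma coe_lower {m' : SimplexCategory} (g : m' ⟶ n) (h : ∀ i, γ ⟨g.toOrderHom i⟩ ≠ ⊤)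
    (i : Fin (m'.len + 1)) :
    WithTop.some ⟨(γ.lower g h).toOrderHom i⟩ = γ ⟨g.toOrderHom i⟩ :=
  WithTop.coe_untop _ _

lemma lower_eq_iff {m' : SimplexCategory} (g : m' ⟶ n) (h : ∀ i, γ ⟨g.toOrderHom i⟩ ≠ ⊤)
    (f : m' ⟶ m) : γ.lower g h = f ↔
      ∀ i, WithTop.some ⟨f.toOrderHom i⟩ = γ ⟨g.toOrderHom i⟩ := by
  refine ⟨?_, fun hf => ?_⟩
  · rintro rfl i
    exact γ.coe_lower g h i
  · ext i : 3
    have := (γ.coe_lower g h i).trans (hf i).symm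
    exact congrArg ULift.down (WithTop.coe_injective this)

end TopMap

/-- The simplex of the cone given by a simplex of `X` and a map to its cone. -/
noncomputable def coneSimplex {n m : SimplexCategory} (γ : TopMap.{u} n m) (y : X.obj (op m)) :
    (cone X).obj (op n) :=
  ({ cut := γ.cut
     left := fun m' g hg => X.map (γ.lower g fun i =>
      (γ.cut_eq_zero_iff _).1 ((TopMap.comp_eq_const_iff g _).1 hg i)).op y
     left_map := fun α g hg hg' => by
      rw [← Functor.map_comp_apply]
      rfl
     right := fun m' _ _ => SSet.stdSimplex.objEquiv.symm (SimplexCategory.const m' (.mk 0) 0)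
     right_map := fun _ _ _ _ => SSet.stdSimplex.objEquiv.injective (by ext; simp) } :
    JoinSimplex X (SSet.stdSimplex.{u}.obj (.mk 0)) n)

lemma map_coneSimplex {n' n m : SimplexCategory} (β : n' ⟶ n) (γ : TopMap.{u} n m)
    (y : X.obj (op m)) : (cone X).map β.op (coneSimplex γ y) =
      coneSimplex (γ.comp β.toOrderHom.uliftMap) y :=
  cone_ext rfl fun _ _ _ _ => rfl

/-- A pair `(γ, y)` stands for the composite of `γ : [n] → [m] ∪ {⊤}` with the cone on `y`;
operators can be moved from `y` to `γ`. -/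
lemma coneSimplex_map {n m m' : SimplexCategory} (α : m ⟶ m') (γ : TopMap.{u} n m)
    (y : X.obj (op m')) : coneSimplex γ (X.map α.op y) = coneSimplex ((opTop α).comp γ) y := by
  refine cone_ext ?_ fun m₁ g hg hg' => ?_
  · change γ.cut = TopMap.cut ((opTop α).comp γ)
    ext i : 3
    change (open Classical in if γ ⟨i⟩ = ⊤ then 1 else 0) =
      (open Classical in if (γ ⟨i⟩).map _ = ⊤ then 1 else 0)
    simp only [WithTop.map_eq_top_iff]
  · change X.map (γ.lower g _).op (X.map α.op y) = X.map (TopMap.lower ((opTop α).comp γ) g _).op y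
    rw [← Functor.map_comp_apply, ← op_comp]
    refine congrArg (fun f => X.map (Quiver.Hom.op f) y)
      ((TopMap.lower_eq_iff _ _ _ _).2 fun i => ?_).symm
    change _ = WithTop.map _ (γ ⟨g.toOrderHom i⟩)
    rw [← γ.coe_lower g]
    rfl

lemma coneMap_coneSimplex {X' : SSet.{u}} (v : X ⟶ X') {n m : SimplexCategory}
    (γ : TopMap.{u} n m) (y : X.obj (op m)) :
    (coneMap v).app _ (coneSimplex γ y) = coneSimplex γ (v.app _ y) :=
  cone_ext rfl fun _ _ _ _ => NatTrans.naturality_apply v _ y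

lemma coneInl_app {m : SimplexCategory} (y : X.obj (op m)) :
    (coneInl X).app _ y = coneSimplex (coeTop _) y :=
  cone_ext (by
    refine SimplexCategory.Hom.ext _ _ (OrderHom.ext _ _ (funext fun i => ?_))
    exact ((TopMap.cut_eq_zero_iff (coeTop _) i).2 (WithTop.coe_ne_top)).symm)
    fun _ g _ _ => congrArg (fun f => X.map (Quiver.Hom.op f) y)
      ((TopMap.lower_eq_iff _ _ _ _).2 fun _ => rfl).symm

/-! ### The canonical form of the simplices of the cone -/

section Retract

variable {n : SimplexCategory} (c : n ⟶ .mk 1)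

/-- The largest element of `c⁻¹ 0` below `i`, if there is one. -/
noncomputable def retractFun (i : Fin (n.len + 1)) : Fin (n.len + 1) :=
  -- The value is the bottom element `0` when no such `j` exists.
  (Finset.univ.filter fun j => j ≤ i ∧ c.toOrderHom j = 0).sup id

/-- A retraction of `[n]` on `c⁻¹ 0`, if this is not empty. -/
noncomputable def retract : n ⟶ n :=
  SimplexCategory.Hom.mk
    { toFun := retractFun c
      monotone' := fun i i' h => Finset.sup_mono fun j hj => by
        simp only [Finset.mem_filter, Finset.mem_univ, true_and] at hj ⊢
        exact ⟨hj.1.trans h, hj.2⟩ }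

/-- The supremum is a maximum of elements of `c⁻¹ 0`, or the default `0`, which lies in `c⁻¹ 0` by
`h`. -/
lemma retract_comp (h : c.toOrderHom 0 = 0) :
    retract c ≫ c = SimplexCategory.const n (.mk 1) 0 := by
  refine (TopMap.comp_eq_const_iff _ _).2 fun i => ?_
  change c.toOrderHom (retractFun c i) = 0
  refine Finset.sup_induction (p := fun j => c.toOrderHom j = 0) h ?_ fun j hj => ?_
  · intro a ha b hb
    rcases max_choice a b with h | h <;> rw [h] <;> assumption
  · exact (Finset.mem_filter.1 hj).2.2

lemma retract_apply (i : Fin (n.len + 1)) (h : c.toOrderHom i = 0) :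
    (retract c).toOrderHom i = i :=
  show retractFun c i = i from le_antisymm (Finset.sup_le fun j hj => (Finset.mem_filter.1 hj).2.1)
    (Finset.le_sup (f := id) (by simpa using h))

/-- The map to the cone which is the identity on `c⁻¹ 0` and sends `c⁻¹ 1` to `⊤`. -/
def cutTop : TopMap.{u} n n where
  toFun i := if c.toOrderHom i.down = 0 then WithTop.some i else ⊤
  monotone' i j h := by
    have hc := c.toOrderHom.monotone (ULift.down_le.2 h)
    dsimp only
    split_ifs with h₁ h₂
    · exact WithTop.coe_le_coe.2 h
    · exact le_top
    · exact (h₁ (le_antisymm (by rwa [‹c.toOrderHom j.down = 0›] at hc) (Fin.zero_le _))).elim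
    · exact le_top

lemma cutTop_apply (i : Fin (n.len + 1)) :
    cutTop.{u} c ⟨i⟩ = if c.toOrderHom i = 0 then WithTop.some ⟨i⟩ else ⊤ := rfl

lemma cutTop_cut : (cutTop.{u} c).cut = c := by
  refine SimplexCategory.Hom.ext _ _ (OrderHom.ext _ _ (funext fun i => ?_))
  by_cases h : c.toOrderHom i = 0
  · refine ((TopMap.cut_eq_zero_iff _ i).2 ?_).trans h.symm
    simp [cutTop_apply, h]
  · have h' : (cutTop.{u} c).cut.toOrderHom i ≠ 0 := fun h' =>
      (TopMap.cut_eq_zero_iff _ i).1 h' (by simp [cutTop_apply, h])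
    exact (Fin.eq_one_of_ne_zero _ h').trans (Fin.eq_one_of_ne_zero _ h).symm

end Retract

/-- As the cut is monotone, `h` says that the part of `w` in `X` is nonempty. Extending this part
degenerately along the retraction yields an `n`-simplex of `X`, so no change of dimension is needed.
Nothing is lost, since the retraction fixes every face on which the part in `X` is defined. -/
lemma eq_coneSimplex {n : SimplexCategory} (w : JoinSimplex X (SSet.stdSimplex.{u}.obj (.mk 0)) n)
    (h : w.cut.toOrderHom 0 = 0) :
    w = coneSimplex (cutTop w.cut) (w.left n (retract w.cut) (retract_comp _ h)) := by
  refine cone_ext (cutTop_cut _).symm fun m g hg hg' => ?_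
  have hl : TopMap.lower (cutTop.{u} w.cut) g (fun i =>
      (TopMap.cut_eq_zero_iff _ _).1 ((TopMap.comp_eq_const_iff g _).1 hg' i)) = g := by
    refine (TopMap.lower_eq_iff _ _ _ _).2 fun i => ?_
    have := (TopMap.comp_eq_const_iff g _).1 hg i
    simp [cutTop_apply, this]
  have hr : g ≫ retract w.cut = g := by
    ext i : 3
    exact retract_apply _ _ ((TopMap.comp_eq_const_iff g _).1 hg i)
  change _ = X.map (Quiver.Hom.op _) _
  rw [hl, w.left_map g (retract w.cut) _ (by rw [hr, hg])]
  exact w.left_congr hr.symm _ _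

/-- A monotone cut that starts at `1` is constant, so `w` has no part in `X` and `cone_ext` applies.
-/
lemma eq_coneVertex {n : SimplexCategory} (w : JoinSimplex X (SSet.stdSimplex.{u}.obj (.mk 0)) n)
    (h : w.cut.toOrderHom 0 ≠ 0) :
    w = (cone X).map (SimplexCategory.const n (.mk 0) 0).op (coneVertex X) := by
  have hc : w.cut = SimplexCategory.const n (.mk 1) 1 := by
    refine SimplexCategory.Hom.ext _ _ (OrderHom.ext _ _ (funext fun i => ?_))
    refine Fin.eq_one_of_ne_zero _ fun hi => h (le_antisymm ?_ (Fin.zero_le _))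
    exact (w.cut.toOrderHom.monotone (Fin.zero_le i)).trans hi.le
  refine cone_ext hc fun m g hg _ => ?_
  rw [hc] at hg
  exact (const_ne m hg.symm).elim

end ConeSimplex

lemma hmap_hcast {C D : Type u} [EnrichedCategory SSet.{u} C] [EnrichedCategory SSet.{u} D]
    (F : EnrichedFunctor SSet.{u} C D) {x y x' y' : C} (hx : x = x') (hy : y = y')
    {k : SimplexCategoryᵒᵖ} (f : (x ⟶[SSet.{u}] y).obj k) :
    hmap F (hcast hx hy f) = hcast (congrArg F.obj hx) (congrArg F.obj hy) (hmap F f) := by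
  subst hx hy
  rfl

lemma hcast_hmap' {C D : Type u} [EnrichedCategory SSet.{u} C] [EnrichedCategory SSet.{u} D]
    {F G : EnrichedFunctor SSet.{u} C D} (h : F = G) {x y : C} {x' y' : D}
    (hx : F.obj x = x') (hy : F.obj y = y') (hx' : G.obj x = x') (hy' : G.obj y = y')
    {k : SimplexCategoryᵒᵖ} (f : (x ⟶[SSet.{u}] y).obj k) :
    hcast hx hy (hmap F f) = hcast hx' hy' (hmap G f) := by
  subst h
  rfl

lemma pathFunctor_comp {S T U : SSet.{u}} (f : S ⟶ T) (g : T ⟶ U) :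
    (pathFunctor f).comp SSet.{u} (pathFunctor g) = pathFunctor (f ≫ g) :=
  pathCat_functor_ext fun m z => by
    rw [← eFunctor_assoc, pathIota_pathFunctor, pathIota_pathFunctor, pathIota_pathFunctor]
    rfl

/-! ### The functors from thickenings of cones to the path category of a cone -/

section ConeIota

variable {X : SSet.{u}}

/-- The identification of `[m + 1]` with the cone on `[m]`. -/
def succTop (m : SimplexCategory) : TopMap.{u} (.mk (m.len + 1)) m where
  toFun i := if h : i.down.val < m.len + 1 then WithTop.some ⟨⟨i.down.val, h⟩⟩ else ⊤
  monotone' i j h := by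
    have h : i.down.val ≤ j.down.val := ULift.down_le.2 h
    dsimp only
    split_ifs with h₁ h₂
    · exact WithTop.coe_le_coe.2 h
    · exact le_top
    · omega
    · exact le_top

/-- The identification of the cone on `[m]` with `[m + 1]`. -/
def topSucc (m : SimplexCategory) : WithTop (ULift.{u} (Fin (m.len + 1))) →o
    ULift.{u} (Fin ((SimplexCategory.mk (m.len + 1)).len + 1)) where
  toFun
    | some i => ⟨i.down.castSucc⟩
    | none => ⟨Fin.last _⟩
  monotone'
    | some i, some j, h => (WithTop.coe_le_coe.1 h : i ≤ j)
    | some _, none, _ => Fin.le_last _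
    | none, none, _ => le_rfl
    | none, some j, h => ((WithTop.coe_lt_top j).not_ge h).elim

lemma succTop_topSucc (m : SimplexCategory) :
    (succTop.{u} m).comp (topSucc m) = OrderHom.id := by
  ext1
  funext i
  match i with
  | some i => exact dif_pos i.down.isLt
  | none => exact dif_neg (lt_irrefl _)

/-- The functor to `ℭ(X * Δ⁰)` given by the cone on a simplex of `X`. -/
noncomputable def coneIota {m : SimplexCategory} (y : X.obj (op m)) :
    EnrichedFunctor SSet.{u} (SimplicialThickening (WithTop (ULift.{u} (Fin (m.len + 1)))))
      (PathCat (cone X)) :=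
  (SimplicialThickening.functor (topSucc m)).comp SSet.{u}
    (pathIota (coneSimplex (succTop m) y))

/-- The cone on `y` is an `(m + 1)`-simplex, and `(γ, y)` is its pullback along `γ` read as an
operator into `[m + 1]`; then `pathIota_map` applies. -/
lemma pathIota_coneSimplex {n m : SimplexCategory} (γ : TopMap.{u} n m) (y : X.obj (op m)) :
    pathIota (coneSimplex γ y) =
      (SimplicialThickening.functor γ).comp SSet.{u} (coneIota y) := by
  let α : n ⟶ .mk (m.len + 1) := SimplexCategory.Hom.mk
    { toFun := fun i => (topSucc m (γ ⟨i⟩)).down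
      monotone' := fun i j h => (topSucc m).monotone (γ.monotone (ULift.up_le.2 h)) }
  have hα : α.toOrderHom.uliftMap = (topSucc m).comp γ := rfl
  have h := pathIota_map α (coneSimplex (succTop m) y)
  rw [map_coneSimplex, hα, ← OrderHom.comp_assoc, succTop_topSucc, OrderHom.id_comp,
    Thick.map, hα, SimplicialThickening.functor_comp, eFunctor_assoc] at h
  exact h

lemma coneIota_map {m m' : SimplexCategory} (α : m ⟶ m') (y : X.obj (op m')) :
    coneIota (X.map α.op y) = (thickTopMap α).comp SSet.{u} (coneIota y) := by
  rw [coneIota, coneSimplex_map, pathIota_coneSimplex, ← eFunctor_assoc,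
    ← SimplicialThickening.functor_comp, OrderHom.comp_assoc, succTop_topSucc, OrderHom.comp_id]

lemma coneIota_coneMap {X' : SSet.{u}} (v : X ⟶ X') {m : SimplexCategory} (y : X.obj (op m)) :
    (coneIota y).comp SSet.{u} (pathFunctor (coneMap v)) = coneIota (v.app _ y) := by
  rw [coneIota, eFunctor_assoc, pathIota_pathFunctor, coneMap_coneSimplex, coneIota]

lemma thickIncl_coneIota {m : SimplexCategory} (y : X.obj (op m)) :
    (thickIncl _).comp SSet.{u} (coneIota y) =
      (pathIota y).comp SSet.{u} (pathFunctor (coneInl X)) := by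
  rw [pathIota_pathFunctor, coneInl_app, pathIota_coneSimplex]

lemma map_const_zero {Y : SSet.{u}} (s : Vert Y) :
    Y.map (SimplexCategory.const (.mk 0) (.mk 0) 0).op s = s := by
  rw [SimplexCategory.const_eq_id]
  simp

/-- The last element of `[m + 1]` corresponds to `⊤`, so the cut there is `1` and `eq_coneVertex`
identifies the vertex. -/
lemma coneIota_top {m : SimplexCategory} (y : X.obj (op m)) :
    (coneIota y).obj ⟨⊤⟩ = ⟨coneVertex X⟩ := by
  refine congrArg PathCat.mk ?_
  refine (map_coneSimplex _ (succTop m) y).trans ?_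
  refine (eq_coneVertex _ fun h => ?_).trans (map_const_zero _)
  exact (TopMap.cut_eq_zero_iff _ _).1 h (dif_neg (lt_irrefl _))

end ConeIota

/-! ### Generators of the straightening -/

section Gen

variable {X S : SSet.{u}} (p : X ⟶ S)

/-- The functor to `ℭ(S_p)` given by the cone on a simplex of `X`. -/
noncomputable def glueIota {m : SimplexCategory} (y : X.obj (op m)) :
    EnrichedFunctor SSet.{u} (SimplicialThickening (WithTop (ULift.{u} (Fin (m.len + 1)))))
      (PathCat (glue p)) :=
  (coneIota y).comp SSet.{u} (pathFunctor (glueInr p))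

/-- This is the commutativity of the pushout square defining `S_p`. -/
lemma thickIncl_glueIota {m : SimplexCategory} (y : X.obj (op m)) :
    (thickIncl _).comp SSet.{u} (glueIota p y) =
      (pathIota (p.app _ y)).comp SSet.{u} (pathFunctor (glueInl p)) := by
  rw [glueIota, ← eFunctor_assoc, thickIncl_coneIota, eFunctor_assoc, pathFunctor_comp,
    ← pathIota_pathFunctor, eFunctor_assoc, pathFunctor_comp]
  exact congrArg (fun f => EnrichedFunctor.comp SSet.{u} (pathIota y) (pathFunctor f))
    pushout.condition.symm

lemma glueIota_top {m : SimplexCategory} (y : X.obj (op m)) :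
    (glueIota p y).obj ⟨⊤⟩ = ⟨glueVertex p⟩ :=
  congrArg (pathFunctor (glueInr p)).obj (coneIota_top y)

lemma glueIota_map {m m' : SimplexCategory} (α : m ⟶ m') (y : X.obj (op m')) :
    glueIota p (X.map α.op y) = (thickTopMap α).comp SSet.{u} (glueIota p y) := by
  rw [glueIota, coneIota_map, eFunctor_assoc, glueIota]

lemma glueIota_glueMap {p : X ⟶ S} {X' S' : SSet.{u}} {p' : X' ⟶ S'} (v : X ⟶ X') (w : S ⟶ S')
    (h : p ≫ w = v ≫ p') {m : SimplexCategory} (y : X.obj (op m)) :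
    (glueIota p y).comp SSet.{u} (pathFunctor (glueMap v w h)) = glueIota p' (v.app _ y) := by
  rw [glueIota, eFunctor_assoc, pathFunctor_comp, glueInr_glueMap, ← pathFunctor_comp,
    ← eFunctor_assoc, coneIota_coneMap, glueIota]

lemma glueIota_obj {m : SimplexCategory} (y : X.obj (op m)) {i : Thick.{u} m} {s : Vert S}
    (hs : vertex (p.app _ y) i = s) :
    (glueIota p y).obj ((thickIncl _).obj i) = (pathFunctor (glueInl p)).obj ⟨s⟩ :=
  (congrArg (fun F => F.obj i) (thickIncl_glueIota p y)).trans
    (congrArg (fun s => (pathFunctor (glueInl p)).obj ⟨s⟩) hs)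

/-- The generators of `Str(p)`. -/
noncomputable def strGen {m : SimplexCategory} (y : X.obj (op m)) {i : Thick.{u} m}
    {k : SimplexCategoryᵒᵖ} (a : ((thickWeight m).obj i).obj k) (s : Vert S)
    (hs : vertex (p.app _ y) i = s) : ((str p).obj ⟨s⟩).obj k :=
  hcast (D := PathCat (glue p)) (glueIota_obj p y hs) (glueIota_top p y) (hmap (glueIota p y) a)

/-- With `strGen_smul` and `strGen_map` this says that the generators attached to `y` form a simplex
of the unstraightening of `Str(p)` over `p y`, naturally in `y`: the unit of the adjunction. -/
lemma map_strGen {m : SimplexCategory} (y : X.obj (op m)) {i : Thick.{u} m}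
    {k k' : SimplexCategoryᵒᵖ} (β : k ⟶ k') (a : ((thickWeight m).obj i).obj k) (s : Vert S)
    (hs : vertex (p.app _ y) i = s) :
    ((str p).obj ⟨s⟩).map β (strGen p y a s hs) =
      strGen p y (((thickWeight m).obj i).map β a) s hs :=
  (map_hcast _ _ β _).trans (congrArg (hcast _ _) (map_hmap (glueIota p y) β a))

lemma strGen_smul {m : SimplexCategory} (y : X.obj (op m)) {i j : Thick.{u} m}
    {k : SimplexCategoryᵒᵖ} (f : (i ⟶[SSet.{u}] j).obj k) (a : ((thickWeight m).obj j).obj k)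
    (s t : Vert S) (hs : vertex (p.app _ y) i = s) (ht : vertex (p.app _ y) j = t) :
    strGen p y ((thickWeight m).smul f a) s hs =
      (str p).smul (pathOf (p.app _ y) f hs ht) (strGen p y a t ht) := by
  refine (congrArg (hcast _ _) (hmap_hcomp (glueIota p y) (hmap (thickIncl _) f) a)).trans ?_
  refine (hcast_hcomp _ (glueIota_obj p y ht) _ _ _).trans ?_
  refine congrArg (fun g => hcomp g (strGen p y a t ht)) ?_
  subst hs ht
  exact hcast_hmap (thickIncl_glueIota p y) f

/-- Stated for arbitrary functors and endpoints so that the equality `h` can be substituted. -/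
lemma hcast_hmap_weightMap {D : Type u} [EnrichedCategory SSet.{u} D] {m m' : SimplexCategory}
    (α : m ⟶ m') {F : EnrichedFunctor SSet.{u} (SimplicialThickening _) D}
    {G : EnrichedFunctor SSet.{u} (SimplicialThickening _) D}
    (h : F = (thickTopMap α).comp SSet.{u} G) {i : Thick.{u} m} {k : SimplexCategoryᵒᵖ}
    (a : ((thickWeight m).obj i).obj k) {x y : D} (hx : F.obj ((thickIncl _).obj i) = x)
    (hy : F.obj ⟨⊤⟩ = y) (hx' : G.obj ((thickIncl _).obj ((Thick.map α).obj i)) = x)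
    (hy' : G.obj ⟨⊤⟩ = y) :
    hcast hx hy (hmap F a) = hcast hx' hy' (hmap G (weightMap α a)) := by
  subst h
  rfl

lemma strGen_map {m m' : SimplexCategory} (α : m ⟶ m') (y : X.obj (op m')) {i : Thick.{u} m}
    {k : SimplexCategoryᵒᵖ} (a : ((thickWeight m).obj i).obj k) (s : Vert S)
    (hs : vertex (p.app _ (X.map α.op y)) i = s)
    (hs' : vertex (p.app _ y) ((Thick.map α).obj i) = s) :
    strGen p (X.map α.op y) a s hs = strGen p y (weightMap α a) s hs' := by
  unfold strGen
  exact hcast_hmap_weightMap α (glueIota_map p α y) a _ _ _ _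

/-- Generators go to generators because the induced map `S_p → S'_{p'}` carries the cone on `y` to
the cone on `v y`. -/
lemma strMap_strGen {p : X ⟶ S} {X' S' : SSet.{u}} {p' : X' ⟶ S'} (v : X ⟶ X') (w : S ⟶ S')
    (h : p ≫ w = v ≫ p') {m : SimplexCategory} (y : X.obj (op m)) {i : Thick.{u} m}
    {k : SimplexCategoryᵒᵖ} (a : ((thickWeight m).obj i).obj k) (s : Vert S)
    (hs : vertex (p.app _ y) i = s) (s' : Vert S') (e : w.app _ s = s')
    (hs' : vertex (p'.app _ (v.app _ y)) i = s') :
    (strMap v w h (s := ⟨s⟩) (s' := ⟨s'⟩) e).app k (strGen p y a s hs) =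
      strGen p' (v.app _ y) a s' hs' := by
  refine (pathMap_eq_hcast (glueMap v w h)
    (s := (pathFunctor (glueInl p)).obj ⟨s⟩) (t := ⟨glueVertex p⟩)
    (s' := (pathFunctor (glueInl p')).obj ⟨s'⟩) (t' := ⟨glueVertex p'⟩) _ _ _).trans ?_
  refine (congrArg (hcast _ _) (hmap_hcast (pathFunctor (glueMap v w h)) _ _ _)).trans ?_
  refine (hcast_hcast _ _ _ _ _).trans ?_
  exact hcast_hmap' (glueIota_glueMap v w h y) _ _ _ _ a

end Gen

/-! ### Transformations out of the straightening: existence -/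

section Existence

variable {X S : SSet.{u}} {p : X ⟶ S} {Q : SPresheaf (PathCat S)}

/-- The functor to a collage that is constant at the new object. -/
def constTop (A : Type u) [EnrichedCategory SSet.{u} A] (Q : SPresheaf (PathCat S)) :
    EnrichedFunctor SSet.{u} A (Collage Q) where
  obj _ := .top
  map _ _ := { app := fun _ => ↾fun _ => PUnit.unit }
  map_id _ := rfl
  map_comp _ _ _ := rfl

/-- The endomorphism space of `top` is a point, so the values on objects determine the functor. -/
lemma eq_constTop {A : Type u} [EnrichedCategory SSet.{u} A]
    (F : EnrichedFunctor SSet.{u} A (Collage Q)) (h : ∀ x, F.obj x = .top) : F = constTop A Q :=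
  eFunctor_ext h fun _ _ _ _ => rfl

variable (ψ : X ⟶ unTotal Q)

/-- The simplex of the unstraightening of `Q` that is the image of `y`. -/
abbrev unApp {m : SimplexCategory} (y : X.obj (op m)) : UnSimplex Q m := ψ.app (op m) y

lemma unApp_map {m m' : SimplexCategory} (α : m ⟶ m') (y : X.obj (op m')) :
    unApp ψ (X.map α.op y) = (unApp ψ y).pull α :=
  NatTrans.naturality_apply ψ α.op y

/-- The functor `ℭ[Δⁿ] → Collage Q` given by a simplex of the cone on `X`. -/
noncomputable def coneSimplexFunctor {n : SimplexCategory} (w : (cone X).obj (op n)) :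
    EnrichedFunctor SSet.{u} (Thick.{u} n) (Collage Q) :=
  open Classical in
  if h : (JoinSimplex.cut w).toOrderHom 0 = 0 then
    (SimplicialThickening.functor (cutTop (JoinSimplex.cut w))).comp SSet.{u}
      (unApp ψ (JoinSimplex.left w n (retract (JoinSimplex.cut w))
        (retract_comp _ h))).toFunctor
  else constTop _ Q

lemma coneSimplexFunctor_of_ne {n : SimplexCategory} (w : (cone X).obj (op n))
    (h : (JoinSimplex.cut w).toOrderHom 0 ≠ 0) : coneSimplexFunctor ψ w = constTop _ Q :=
  dif_neg h

/-- The definition uses the canonical form of a simplex; this gives the value on any presentation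
`(γ, y)`, from which naturality follows. -/
lemma coneSimplexFunctor_coneSimplex {n m : SimplexCategory} (γ : TopMap.{u} n m)
    (y : X.obj (op m)) : coneSimplexFunctor ψ (coneSimplex γ y) =
      (SimplicialThickening.functor γ).comp SSet.{u} (unApp ψ y).toFunctor := by
  by_cases h : γ.cut.toOrderHom 0 = 0
  · refine (dif_pos h).trans ?_
    change (SimplicialThickening.functor (cutTop γ.cut)).comp SSet.{u}
      (unApp ψ (X.map (Quiver.Hom.op _) y)).toFunctor = _
    rw [unApp_map, UnSimplex.pull_toFunctor, ← eFunctor_assoc,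
      ← SimplicialThickening.functor_comp]
    -- What remains concerns monotone maps: `cutTop γ.cut` followed by the cone on the lowered
    -- retraction is `γ`, checked separately off and on `γ⁻¹ ⊤`.
    congr 2
    ext1
    funext ⟨i⟩
    change WithTop.map _ (cutTop γ.cut ⟨i⟩) = γ ⟨i⟩
    rw [cutTop_apply]
    split_ifs with hi
    · refine (γ.coe_lower (retract γ.cut) _ i).trans ?_
      rw [retract_apply _ i hi]
    · exact (not_not.1 (mt (γ.cut_eq_zero_iff i).2 hi)).symm
  · refine (dif_neg h).trans (eq_constTop _ fun i => ?_).symm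
    -- Here `γ` starts at `⊤`, hence is constant.
    have h0 : γ ⟨0⟩ = ⊤ := not_not.1 (mt (γ.cut_eq_zero_iff 0).2 h)
    have hi : γ i.as = ⊤ := top_le_iff.1 (h0 ▸ γ.monotone (ULift.up_le.2 (Fin.zero_le _)))
    change (unApp ψ y).toFunctor.obj ⟨γ i.as⟩ = .top
    rw [hi]
    rfl

/-- The map `X * Δ⁰ → N(Collage Q)` determined by a map from `X` to the unstraightening of `Q`. -/
noncomputable def coneNerve : cone X ⟶ cohNerve (Collage Q) where
  app n := ↾fun w => coneSimplexFunctor ψ (n := n.unop) w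
  naturality n n' β := by
    ext w
    change coneSimplexFunctor ψ ((cone X).map β.unop.op w) =
      (Thick.map β.unop).comp SSet.{u} (coneSimplexFunctor ψ w)
    by_cases h : (JoinSimplex.cut w).toOrderHom 0 = 0
    · obtain ⟨γ, y, rfl⟩ : ∃ (γ : TopMap.{u} n.unop n.unop) (y : X.obj (op n.unop)),
        w = coneSimplex γ y := ⟨_, _, eq_coneSimplex w h⟩
      rw [map_coneSimplex, coneSimplexFunctor_coneSimplex, coneSimplexFunctor_coneSimplex,
        SimplicialThickening.functor_comp, eFunctor_assoc]
    · rw [coneSimplexFunctor_of_ne ψ w h, coneSimplexFunctor_of_ne ψ]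
      · exact (eq_constTop _ fun _ => rfl).symm
      -- A cut that is nonzero at `0` is nonzero everywhere, so it stays so after pulling back along
      -- `β`.
      · refine fun h' => h (le_antisymm ?_ (Fin.zero_le _))
        exact ((JoinSimplex.cut w).toOrderHom.monotone (Fin.zero_le _)).trans h'.le

/-- The map `S_p → N(Collage Q)` determined by a map over `S` from `X` to the unstraightening
of `Q`. -/
noncomputable def glueNerve (hψ : ψ ≫ (unstraighten Q).hom = p) :
    glue p ⟶ cohNerve (Collage Q) :=
  pushout.desc (toNerve (Collage.incl Q)) (coneNerve ψ) (by
    subst hψ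
    ext m y
    -- The two maps agree on `X` because the functor of `ψ y` restricts on `[m]` to the simplex of
    -- `S` underlying `ψ y`.
    refine (UnSimplex.thickIncl_toFunctor (unApp ψ (m := m.unop) y)).symm.trans ?_
    refine (coneSimplexFunctor_coneSimplex ψ (coeTop _) y).symm.trans ?_
    exact congrArg (coneSimplexFunctor ψ) (coneInl_app (m := m.unop) y).symm)

variable (hψ : ψ ≫ (unstraighten Q).hom = p)

/-- The functor `ℭ(S_p) → Collage Q` determined by a map over `S` from `X` to the unstraightening
of `Q`. -/
noncomputable def glueFunctor : EnrichedFunctor SSet.{u} (PathCat (glue p)) (Collage Q) :=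
  nerveTranspose (glueNerve ψ hψ)

lemma glueInl_glueNerve : glueInl p ≫ glueNerve ψ hψ = toNerve (Collage.incl Q) :=
  pushout.inl_desc _ _ _

lemma glueInr_glueNerve : glueInr p ≫ glueNerve ψ hψ = coneNerve ψ :=
  pushout.inr_desc _ _ _

lemma glueInl_glueFunctor :
    (pathFunctor (glueInl p)).comp SSet.{u} (glueFunctor ψ hψ) = Collage.incl Q :=
  pathCat_functor_ext fun m σ => by
    rw [← eFunctor_assoc, pathIota_pathFunctor, glueFunctor, pathIota_nerveTranspose]
    exact congrArg (fun f => f.app (op m) σ) (glueInl_glueNerve ψ hψ)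

lemma glueNerve_glueInr {m : SimplexCategory} (w : (cone X).obj (op m)) :
    (glueNerve ψ hψ).app (op m) ((glueInr p).app (op m) w) = coneSimplexFunctor ψ w :=
  congrArg (fun f => f.app (op m) w) (glueInr_glueNerve ψ hψ)

lemma glueFunctor_vertex : (glueFunctor ψ hψ).obj ⟨glueVertex p⟩ = .top := by
  have : coneSimplexFunctor ψ (coneVertex X) = constTop _ Q :=
    coneSimplexFunctor_of_ne _ _ (by
      change (1 : Fin 2) ≠ 0
      simp)
  exact congrArg (fun F => F.obj ⟨⟨0⟩⟩) ((glueNerve_glueInr ψ hψ (coneVertex X)).trans this)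

/-- The transpose takes the prescribed value on the `(m + 1)`-simplex that is the cone on `y`; the
identification of `[m + 1]` with `[m] ∪ {⊤}` then cancels. -/
lemma glueIota_glueFunctor {m : SimplexCategory} (y : X.obj (op m)) :
    (glueIota p y).comp SSet.{u} (glueFunctor ψ hψ) = (unApp ψ y).toFunctor := by
  rw [glueIota, coneIota, eFunctor_assoc, eFunctor_assoc, ← eFunctor_assoc (pathIota _),
    pathIota_pathFunctor, glueFunctor,
    pathIota_nerveTranspose, glueNerve_glueInr, coneSimplexFunctor_coneSimplex, ← eFunctor_assoc,
    ← SimplicialThickening.functor_comp, succTop_topSucc, SimplicialThickening.functor_id]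
  exact eFunctor_ext (fun _ => rfl) fun _ _ _ _ => rfl

lemma glueFunctor_obj (s : PathCat S) :
    (glueFunctor ψ hψ).obj ((pathFunctor (glueInl p)).obj s) = .inl s :=
  congrArg (fun F => F.obj s) (glueInl_glueFunctor ψ hψ)

/-- The transformation `Str(p) → Q` determined by a map over `S` from `X` to the unstraightening
of `Q`. -/
noncomputable def strDesc : str p ⟶ Q where
  app s :=
    { app := fun k => ↾fun a => hcast (D := Collage Q) (x' := .inl s) (y' := .top)
        (glueFunctor_obj ψ hψ s) (glueFunctor_vertex ψ hψ) (hmap (glueFunctor ψ hψ) a)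
      naturality := fun k k' β => by
        ext a
        exact ((map_hcast _ _ β _).trans (congrArg (hcast _ _)
          (map_hmap (glueFunctor ψ hψ) β a))).symm }
  app_smul {s t k} f a := by
    refine (congrArg (hcast _ _) (hmap_hcomp (glueFunctor ψ hψ)
      (hmap (pathFunctor (glueInl p)) f) a)).trans ?_
    refine (hcast_hcomp _ (glueFunctor_obj ψ hψ t) _ _ _).trans ?_
    -- Composition into `top` in the collage is the action on `Q`, and the functor restricts to the
    -- inclusion of `ℭ(S)`.
    exact congrArg (fun g => hcomp (x := (.inl s : Collage Q)) (y := .inl t) (z := .top) g _)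
      (hcast_hmap (glueInl_glueFunctor ψ hψ) f)

/-- The generator is the image of `a` under `glueIota p y`, which `glueFunctor` turns into the
functor of `ψ y`; its value at `a` is `val`. Both `hs` and `hs'` occur because `p y` equals the
underlying simplex of `ψ y` only through `hψ`. -/
lemma strDesc_strGen {m : SimplexCategory} (y : X.obj (op m)) {i : Thick.{u} m}
    {k : SimplexCategoryᵒᵖ} (a : ((thickWeight m).obj i).obj k) (s : Vert S)
    (hs : vertex (p.app _ y) i = s) (hs' : vertex (unApp ψ y).pt i = s) :
    ((strDesc ψ hψ).app ⟨s⟩).app k (strGen p y a s hs) = (unApp ψ y).val a s hs' := by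
  refine (congrArg (hcast _ _) (hmap_hcast (glueFunctor ψ hψ) _ _ _)).trans ?_
  refine (hcast_hcast _ _ _ _ _).trans ?_
  refine (hcast_hmap' (glueIota_glueFunctor ψ hψ y) (x := (thickIncl _).obj i) (y := ⟨⊤⟩) _ _
    (congrArg (fun s : Vert S => (Collage.inl ⟨s⟩ : Collage Q)) hs') rfl a).trans ?_
  exact UnSimplex.hcast_val _ a rfl hs' _

end Existence

/-! ### Functors on `ℭ(S_p)`: uniqueness -/

section Uniqueness

/-- Agreement of two functors on an arrow may be tested after renaming its endpoints. -/
lemma hcast_hmap_of_hcast {C D : Type u} [EnrichedCategory SSet.{u} C]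
    [EnrichedCategory SSet.{u} D] {F G : EnrichedFunctor SSet.{u} C D} {x y x' y' : C}
    (hx : x = x') (hy : y = y') {k : SimplexCategoryᵒᵖ} (f : (x ⟶[SSet.{u}] y).obj k)
    {ex' : F.obj x' = G.obj x'} {ey' : F.obj y' = G.obj y'}
    (h : hcast ex' ey' (hmap F (hcast hx hy f)) = hmap G (hcast hx hy f))
    (ex : F.obj x = G.obj x) (ey : F.obj y = G.obj y) :
    hcast ex ey (hmap F f) = hmap G f := by
  subst hx hy
  exact h

variable {X S : SSet.{u}} {p : X ⟶ S} {Q : SPresheaf (PathCat S)}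

/-- The simplex of the unstraightening of `Q` given by a simplex of `X` and a transformation
`Str(p) → Q`. -/
noncomputable def genSimplex (φ : str p ⟶ Q) {m : SimplexCategory} (y : X.obj (op m)) :
    UnSimplex Q m where
  pt := p.app _ y
  val a s hs := (φ.app ⟨s⟩).app _ (strGen p y a s hs)
  map_val β i a s hs := by
    rw [← NatTrans.naturality_apply, map_strGen]
  val_smul f a s t hs ht := by
    rw [strGen_smul p y f a s t hs ht]
    exact φ.app_smul _ _

/-- The map over `S` from `X` to the unstraightening of `Q` given by a transformation
`Str(p) → Q`. -/
noncomputable def toUnTotal (φ : str p ⟶ Q) : X ⟶ unTotal Q where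
  app m := ↾fun y => genSimplex φ (m := m.unop) y
  naturality m m' α := by
    ext y
    change genSimplex φ (X.map α.unop.op y) = (genSimplex φ y).pull α.unop
    refine UnSimplex.ext (by
      change p.app _ (X.map α.unop.op y) = S.map α.unop.op (p.app _ y)
      exact NatTrans.naturality_apply p α.unop.op y) fun k i a s hs hs' => ?_
    exact congrArg ((φ.app ⟨s⟩).app k) (strGen_map p α.unop y a s hs _)

lemma toUnTotal_hom (φ : str p ⟶ Q) : toUnTotal φ ≫ (unstraighten Q).hom = p := rfl

lemma strDesc_toUnTotal_strGen (φ : str p ⟶ Q) {m : SimplexCategory} (y : X.obj (op m))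
    {i : Thick.{u} m} {k : SimplexCategoryᵒᵖ} (a : ((thickWeight m).obj i).obj k) (s : Vert S)
    (hs : vertex (p.app _ y) i = s) :
    ((strDesc (toUnTotal φ) (toUnTotal_hom φ)).app ⟨s⟩).app k (strGen p y a s hs) =
      (φ.app ⟨s⟩).app k (strGen p y a s hs) :=
  strDesc_strGen _ _ y a s hs hs

/-- Functors on the thickening of a point are determined by their values on the object. -/
lemma thick_zero_functor_ext {D : Type u} [EnrichedCategory SSet.{u} D]
    {F G : EnrichedFunctor SSet.{u} (Thick.{u} (.mk 0)) D}
    (h : F.obj ⟨⟨0⟩⟩ = G.obj ⟨⟨0⟩⟩) : F = G := by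
  have ho : ∀ i : Thick.{u} (.mk 0), i = ⟨⟨0⟩⟩ := fun ⟨⟨i⟩⟩ => by
    obtain rfl : i = 0 := Subsingleton.elim (α := Fin 1) _ _
    rfl
  refine eFunctor_ext (fun i => by rw [ho i, h]) fun i j k f => ?_
  obtain rfl := ho i
  obtain rfl := ho j
  obtain rfl := hom_self_eq f
  refine (congrArg (hcast _ _) (hmap_hid F _ k)).trans ?_
  exact (hcast_hid _ _ _).trans (hmap_hid G _ k).symm

/-- Functors on `ℭ(S_p)` are determined by their values on `ℭ(S)` and the generators. -/
lemma glue_functor_ext {D : Type u} [EnrichedCategory SSet.{u} D]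
    {F G : EnrichedFunctor SSet.{u} (PathCat (glue p)) D}
    (h : (pathFunctor (glueInl p)).comp SSet.{u} F = (pathFunctor (glueInl p)).comp SSet.{u} G)
    (ht : F.obj ⟨glueVertex p⟩ = G.obj ⟨glueVertex p⟩)
    (hφ : ∀ (m : SimplexCategory) (y : X.obj (op m)) (i : Thick.{u} m) (k : SimplexCategoryᵒᵖ)
      (a : ((thickWeight m).obj i).obj k),
      hcast (congrArg (fun H => H.obj ⟨vertex (p.app _ y) i⟩) h) ht
        (hmap F (x := (pathFunctor (glueInl p)).obj _) (y := ⟨glueVertex p⟩)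
          (strGen p y a _ rfl)) =
        hmap G (x := (pathFunctor (glueInl p)).obj _) (y := ⟨glueVertex p⟩)
          (strGen p y a _ rfl)) : F = G := by
  -- First the cones on simplices of `X`: on `[m]` the functors agree by `h`, and arrows to `⊤` are
  -- generators.
  have hι : ∀ (m : SimplexCategory) (y : X.obj (op m)),
      (glueIota p y).comp SSet.{u} F = (glueIota p y).comp SSet.{u} G := fun m y => by
    refine thickTop_functor_ext ?_ ?_ fun i k a => ?_
    · rw [← eFunctor_assoc, ← eFunctor_assoc, thickIncl_glueIota, eFunctor_assoc, eFunctor_assoc,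
        h]
    · exact (congrArg F.obj (glueIota_top p y)).trans (ht.trans
        (congrArg G.obj (glueIota_top p y)).symm)
    · exact hcast_hmap_of_hcast (glueIota_obj p y rfl) (glueIota_top p y) (hmap (glueIota p y) a)
        (hφ m y i k a) _ _
  have hS : ∀ (m : SimplexCategory) (z : (glue p).obj (op m)),
      (pathIota z).comp SSet.{u} F = (pathIota z).comp SSet.{u} G := by
    refine fun m z => congrArg (fun φ => φ.app (op m) z)
      (show toNerve F = toNerve G from glue_hom_ext ?_ ?_)
    · ext m z
      change (pathIota ((glueInl p).app (op m.unop) z)).comp SSet.{u} F =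
        (pathIota ((glueInl p).app (op m.unop) z)).comp SSet.{u} G
      rw [← pathIota_pathFunctor, eFunctor_assoc, eFunctor_assoc, h]
    · ext n w
      change (pathIota ((glueInr p).app (op n.unop) w)).comp SSet.{u} F =
        (pathIota ((glueInr p).app (op n.unop) w)).comp SSet.{u} G
      rw [← pathIota_pathFunctor]
      -- A simplex of the cone is either presented by some `(γ, y)`, where `hι` applies, or is a
      -- degeneracy of the cone point, where only the value at `*` matters.
      by_cases hw : (JoinSimplex.cut w).toOrderHom 0 = 0
      · obtain ⟨γ, y, rfl⟩ : ∃ (γ : TopMap.{u} n.unop n.unop) (y : X.obj (op n.unop)),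
          w = coneSimplex γ y := ⟨_, _, eq_coneSimplex w hw⟩
        rw [pathIota_coneSimplex]
        exact congrArg ((SimplicialThickening.functor γ).comp SSet.{u}) (hι _ y)
      · obtain rfl := eq_coneVertex w hw
        rw [pathIota_map, eFunctor_assoc, eFunctor_assoc, eFunctor_assoc, eFunctor_assoc]
        refine congrArg ((Thick.map _).comp SSet.{u}) (thick_zero_functor_ext ?_)
        have hv : (pathIota (coneVertex X)).obj ⟨⟨0⟩⟩ = ⟨coneVertex X⟩ :=
          congrArg PathCat.mk (map_const_zero _)
        refine (congrArg (fun v => F.obj ((pathFunctor (glueInr p)).obj v)) hv).trans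
          (ht.trans ?_)
        exact (congrArg (fun v => G.obj ((pathFunctor (glueInr p)).obj v)) hv).symm
  exact pathCat_functor_ext hS

end Uniqueness

/-! ### Transformations out of the straightening: uniqueness -/

section HomExt

variable {X S : SSet.{u}} (p : X ⟶ S) {Q : SPresheaf (PathCat S)}

/-- The functor from `ℭ(S_p)` to the collage of `Str(p)`. -/
noncomputable def glueToCollage : EnrichedFunctor SSet.{u} (PathCat (glue p)) (Collage (str p)) :=
  glueFunctor (toUnTotal (𝟙 (str p))) (toUnTotal_hom _)

/-- The functor from the collage of `Str(p)` to `ℭ(S_p)`. -/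
noncomputable def collageToGlue : EnrichedFunctor SSet.{u} (Collage (str p)) (PathCat (glue p)) :=
  Collage.desc (pathFunctor (glueInl p)) ⟨glueVertex p⟩ (𝟙 (str p))

lemma hcast_glueToCollage_strGen {m : SimplexCategory} (y : X.obj (op m)) {i : Thick.{u} m}
    {k : SimplexCategoryᵒᵖ} (a : ((thickWeight m).obj i).obj k) (s : Vert S)
    (hs : vertex (p.app _ y) i = s) :
    hcast (D := Collage (str p)) (x' := .inl ⟨s⟩) (y' := .top)
      (glueFunctor_obj _ _ ⟨s⟩) (glueFunctor_vertex _ _)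
      (hmap (glueToCollage p) (x := (pathFunctor (glueInl p)).obj ⟨s⟩) (y := ⟨glueVertex p⟩)
        (strGen p y a s hs)) = strGen p y a s hs :=
  strDesc_toUnTotal_strGen (𝟙 (str p)) y a s hs

/-- Both functors are compatible with the inclusions of `ℭ(S)` and preserve `*` and the generators,
so `glue_functor_ext` identifies the composite with the identity. -/
lemma glueToCollage_collageToGlue :
    (glueToCollage p).comp SSet.{u} (collageToGlue p) = EnrichedFunctor.id SSet.{u} _ := by
  refine glue_functor_ext ?_ (congrArg (collageToGlue p).obj (glueFunctor_vertex _ _))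
    fun m y i k a => ?_
  · rw [← eFunctor_assoc, glueToCollage, glueInl_glueFunctor]
    exact eFunctor_ext (fun _ => rfl) fun _ _ _ _ => rfl
  · exact (hmap_hcast (collageToGlue p) _ _ _).symm.trans
      (congrArg (hmap (collageToGlue p) (x := .inl _) (y := .top))
        (hcast_glueToCollage_strGen p y a _ rfl))

/-- `collageToGlue` is the identity on the mapping spaces to `top`, so the one-sided inverse already
shows that `glueToCollage` fixes all of `Str(p)`, not only the generators. -/
lemma hcast_glueToCollage {s : PathCat S} {k : SimplexCategoryᵒᵖ} (a : ((str p).obj s).obj k) :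
    hcast (D := Collage (str p)) (x' := .inl s) (y' := .top)
      (glueFunctor_obj _ _ s) (glueFunctor_vertex _ _)
      (hmap (glueToCollage p) (x := (pathFunctor (glueInl p)).obj s) (y := ⟨glueVertex p⟩) a) =
      a :=
  (hmap_hcast (collageToGlue p) (glueFunctor_obj _ _ s) (glueFunctor_vertex _ _)
      (hmap (glueToCollage p) (x := (pathFunctor (glueInl p)).obj s)
        (y := ⟨glueVertex p⟩) a)).trans
    (hcast_hmap (glueToCollage_collageToGlue p) (x := (pathFunctor (glueInl p)).obj s)
      (y := ⟨glueVertex p⟩) a)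

variable {p}

/-- The functor between collages induced by a transformation. -/
def collageMap {P : SPresheaf (PathCat S)} (φ : P ⟶ Q) :
    EnrichedFunctor SSet.{u} (Collage P) (Collage Q) :=
  Collage.desc (Collage.incl Q) .top
    (φ : P ⟶ (SPresheaf.restrict (Collage.incl Q)).obj (SPresheaf.representable .top))

/-- Transformations out of `Str(p)` are determined by their values on the generators. -/
lemma str_hom_ext {φ φ' : str p ⟶ Q}
    (h : ∀ (m : SimplexCategory) (y : X.obj (op m)) (i : Thick.{u} m) (k : SimplexCategoryᵒᵖ)
      (a : ((thickWeight m).obj i).obj k) (s : Vert S) (hs : vertex (p.app _ y) i = s),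
      (φ.app ⟨s⟩).app k (strGen p y a s hs) = (φ'.app ⟨s⟩).app k (strGen p y a s hs)) :
    φ = φ' := by
  -- As functors on `ℭ(S_p)`, the two transformations can be compared by `glue_functor_ext`.
  have key : (glueToCollage p).comp SSet.{u} (collageMap φ) =
      (glueToCollage p).comp SSet.{u} (collageMap φ') := by
    refine glue_functor_ext ?_ ?_ fun m y i k a => ?_
    · rw [← eFunctor_assoc, ← eFunctor_assoc, glueToCollage, glueInl_glueFunctor]
      exact eFunctor_ext (fun _ => rfl) fun _ _ _ _ => rfl
    · exact (congrArg (collageMap φ).obj (glueFunctor_vertex _ _)).trans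
        (congrArg (collageMap φ').obj (glueFunctor_vertex _ _)).symm
    · refine hcast_hmap_of_hcast (F := collageMap φ) (G := collageMap φ')
        (glueFunctor_obj _ _ _) (glueFunctor_vertex _ _)
        (hmap (glueToCollage p) (x := (pathFunctor (glueInl p)).obj _) (y := ⟨glueVertex p⟩)
          (strGen p y a _ rfl)) (ex' := rfl) (ey' := rfl) ?_ _ _
      rw [hcast_glueToCollage_strGen]
      exact h m y i k a _ rfl
  ext s k a
  -- Replacing `a` by its image under `glueToCollage` turns the value of `φ` into a value of the
  -- composite functor in `key`.
  refine (congrArg ((φ.app s).app k) (hcast_glueToCollage p a)).symm.trans ?_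
  refine Eq.trans ?_ (congrArg ((φ'.app s).app k) (hcast_glueToCollage p a))
  refine (hmap_hcast (collageMap φ) (glueFunctor_obj _ _ s) (glueFunctor_vertex _ _)
    (hmap (glueToCollage p) (x := (pathFunctor (glueInl p)).obj s)
      (y := ⟨glueVertex p⟩) a)).trans ?_
  refine Eq.trans ?_ (hmap_hcast (collageMap φ') (glueFunctor_obj _ _ s) (glueFunctor_vertex _ _)
    (hmap (glueToCollage p) (x := (pathFunctor (glueInl p)).obj s)
      (y := ⟨glueVertex p⟩) a)).symm
  exact hcast_hmap' key (x := (pathFunctor (glueInl p)).obj s) (y := ⟨glueVertex p⟩) _ _ _ _ a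

end HomExt

/-! ### The adjunction between straightening and unstraightening -/

section Adjunction

variable {S : SSet.{u}}

/-- The bijection between transformations `Str(p) → Q` and maps from `p` to the unstraightening
of `Q`. -/
noncomputable def strHomEquiv (p : Over S) (Q : SPresheaf (PathCat S)) :
    ((straightening S).obj p ⟶ Q) ≃ (p ⟶ unstraighten Q) where
  toFun φ := Over.homMk (toUnTotal φ) (toUnTotal_hom φ)
  invFun ψ := strDesc ψ.left (Over.w ψ)
  left_inv φ := str_hom_ext fun m y i k a s hs => strDesc_toUnTotal_strGen φ y a s hs
  right_inv ψ := by
    -- The underlying simplices agree because `ψ` is a map over `S`.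
    have hp : ∀ (m : SimplexCategoryᵒᵖ) (y : p.left.obj m),
        p.hom.app m y = UnSimplex.pt (ψ.left.app m y) := fun m y =>
      congrArg (fun f => f.app m y) (Over.w ψ).symm
    ext m y
    refine UnSimplex.ext (hp m y) fun k i a s hs hs' => ?_
    exact strDesc_strGen ψ.left (Over.w ψ) (m := m.unop) y a s hs hs'

/-- Straightening sends generators to generators. Naturality in `p` suffices, as the bijections then
determine the action of the right adjoint on transformations. -/
lemma strHomEquiv_naturality {p p' : Over S} {Q : SPresheaf (PathCat S)} (f : p' ⟶ p)
    (φ : (straightening S).obj p ⟶ Q) :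
    strHomEquiv p' Q ((straightening S).map f ≫ φ) = f ≫ strHomEquiv p Q φ := by
  have hp : ∀ (m : SimplexCategoryᵒᵖ) (y : p'.left.obj m),
      p'.hom.app m y = p.hom.app m (f.left.app m y) := fun m y =>
    congrArg (fun f => f.app m y) (Over.w f).symm
  ext m y
  refine UnSimplex.ext (hp m y) fun k i a s hs hs' => ?_
  exact congrArg ((φ.app ⟨s⟩).app k)
    (strMap_strGen f.left (𝟙 S) _ (m := m.unop) y a s hs s rfl hs')

/-- Straightening is left adjoint to unstraightening. -/
noncomputable def strAdjunction (S : SSet.{u}) : straightening S ⊣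
    Adjunction.rightAdjointOfEquiv strHomEquiv fun _ _ _ => strHomEquiv_naturality :=
  Adjunction.adjunctionOfEquivRight strHomEquiv fun _ _ _ => strHomEquiv_naturality

end Adjunction

/-! ### Base change -/

section BaseChange

variable {Y X S : SSet.{u}}

/-- Transport of simplices of the values of a simplicial presheaf along equalities of objects. -/
def SPresheaf.cast {C : Type u} [EnrichedCategory SSet.{u} C] (Q : SPresheaf C) {x y : C}
    (h : x = y) {k : SimplexCategoryᵒᵖ} (a : (Q.obj x).obj k) : (Q.obj y).obj k :=
  h ▸ a

variable {q : Y ⟶ X} {p : X ⟶ S} {Q : SPresheaf (PathCat S)}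
  (θ : str q ⟶ (SPresheaf.restrict (pathFunctor p)).obj Q)

lemma map_vertex (z : X ⟶ S) {m : SimplexCategory} {y : Y.obj (op m)} {i : Thick.{u} m}
    {s : Vert S} (hs : vertex ((q ≫ z).app _ y) i = s) : z.app _ (vertex (q.app _ y) i) = s :=
  (vertex_app z (q.app _ y) i).symm.trans hs

/-- The value on generators of the extension of `θ` to `Str(q ≫ p)`. -/
noncomputable def extendVal {m : SimplexCategory} (y : Y.obj (op m)) {i : Thick.{u} m}
    {k : SimplexCategoryᵒᵖ} (a : ((thickWeight m).obj i).obj k) (s : Vert S)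
    (hs : vertex ((q ≫ p).app _ y) i = s) : (Q.obj ⟨s⟩).obj k :=
  Q.cast (x := ⟨p.app _ (vertex (q.app _ y) i)⟩) (congrArg PathCat.mk (map_vertex p hs))
    ((θ.app ⟨vertex (q.app _ y) i⟩).app k (strGen q y a _ rfl))

/-- At a vertex of the form `p t` the transport disappears; the proofs below first bring `s` into
this form. -/
lemma extendVal_eq {m : SimplexCategory} (y : Y.obj (op m)) {i : Thick.{u} m}
    {k : SimplexCategoryᵒᵖ} (a : ((thickWeight m).obj i).obj k) (t : Vert X)
    (ht : vertex (q.app _ y) i = t) (hs : vertex ((q ≫ p).app _ y) i = p.app _ t) :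
    extendVal θ y a (p.app _ t) hs = (θ.app ⟨t⟩).app k (strGen q y a t ht) := by
  subst ht
  rfl

/-- The simplex of the unstraightening of `Q` given by a simplex of `Y` and `θ`. -/
noncomputable def extendSimplex {m : SimplexCategory} (y : Y.obj (op m)) : UnSimplex Q m where
  pt := (q ≫ p).app _ y
  val a s hs := extendVal θ y a s hs
  map_val {k k'} β i a s hs := by
    obtain rfl := map_vertex p hs
    rw [extendVal_eq θ y _ _ rfl, extendVal_eq θ y _ _ rfl, ← map_strGen]
    exact (NatTrans.naturality_apply (θ.app _) β _).symm
  val_smul f a s t hs ht := by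
    obtain rfl := map_vertex p hs
    obtain rfl := map_vertex p ht
    rw [extendVal_eq θ y _ _ rfl, extendVal_eq θ y _ _ rfl, strGen_smul q y f a _ _ rfl rfl]
    exact θ.app_smul _ _

/-- The map from `Y` to the unstraightening of `Q` given by `θ`. -/
noncomputable def extendTotal : Y ⟶ unTotal Q where
  app m := ↾fun y => extendSimplex θ (m := m.unop) y
  naturality m m' α := by
    ext y
    change extendSimplex θ (Y.map α.unop.op y) = (extendSimplex θ y).pull α.unop
    refine UnSimplex.ext (by
      change (q ≫ p).app _ (Y.map α.unop.op y) = S.map α.unop.op ((q ≫ p).app _ y)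
      exact NatTrans.naturality_apply (q ≫ p) α.unop.op y) fun k i a s hs hs' => ?_
    obtain rfl := map_vertex p hs
    have ht : vertex (q.app _ y) ((Thick.map α.unop).obj i) =
        vertex (q.app _ (Y.map α.unop.op y)) i := by
      rw [NatTrans.naturality_apply, vertex_map]
    refine (extendVal_eq θ (Y.map α.unop.op y) a _ rfl hs).trans
      (Eq.trans ?_ (extendVal_eq θ y (weightMap α.unop a) _ ht
        ((vertex_map α.unop _ i).symm.trans hs')).symm)
    exact congrArg ((θ.app _).app k) (strGen_map q α.unop y a _ rfl ht)

/-- Each generator of `Str(p' ≫ p)` is the image of the generator of `Str(p')` with the same `y` and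
`a`. Injectivity is thus `str_hom_ext`. For surjectivity, the values of `θ` on generators form a map
to the unstraightening of `Q` over `S`, and `strDesc` extends them. -/
lemma restrict_bijective (p' : Over X) (p : X ⟶ S) (Q : SPresheaf (PathCat S)) :
    Function.Bijective fun φ : (Over.map p ⋙ straightening S).obj p' ⟶ Q =>
      (straighteningRestrict p).app p' ≫ (SPresheaf.restrict (pathFunctor p)).map φ := by
  have hgen : ∀ (φ : str (p'.hom ≫ p) ⟶ Q) (m : SimplexCategory) (y : p'.left.obj (op m))
      (i : Thick.{u} m) (k : SimplexCategoryᵒᵖ) (a : ((thickWeight m).obj i).obj k) (t : Vert X)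
      (ht : vertex (p'.hom.app _ y) i = t)
      (hs : vertex ((p'.hom ≫ p).app _ y) i = p.app _ t),
      (((straighteningRestrict p).app p' ≫
        (SPresheaf.restrict (pathFunctor p)).map φ).app ⟨t⟩).app k (strGen p'.hom y a t ht) =
        (φ.app ⟨p.app _ t⟩).app k (strGen (p'.hom ≫ p) y a _ hs) := fun φ m y i k a t ht hs =>
    congrArg ((φ.app ⟨p.app _ t⟩).app k)
      (strMap_strGen (p := p'.hom) (p' := p'.hom ≫ p) (𝟙 _) p (by simp) y a t ht _ rfl hs)
  refine ⟨fun φ φ' h => str_hom_ext fun m y i k a s hs => ?_, fun θ => ?_⟩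
  · obtain rfl := map_vertex p hs
    refine (hgen φ m y i k a _ rfl hs).symm.trans (Eq.trans ?_ (hgen φ' m y i k a _ rfl hs))
    exact congrArg (fun θ : str p'.hom ⟶ _ => (θ.app _).app k (strGen p'.hom y a _ rfl)) h
  · refine ⟨strDesc (extendTotal θ) rfl, str_hom_ext fun m y i k a t ht => ?_⟩
    have hs : vertex ((p'.hom ≫ p).app _ y) i = p.app _ t :=
      (vertex_app p (p'.hom.app _ y) i).trans (congrArg (p.app _) ht)
    refine (hgen _ m y i k a t ht hs).trans ?_
    refine (strDesc_strGen (extendTotal θ) rfl y a _ hs hs).trans ?_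
    exact extendVal_eq θ y a t ht hs

/-- The bijection of a whiskered adjunction is computed objectwise by the original one. -/
lemma baseChange_app (p : X ⟶ S) (p' : Over X) : (baseChange p).app p' =
    ((SPresheaf.lanAdjunction (pathFunctor p)).homEquiv _ _).symm
      ((straighteningRestrict p).app p') := by
  rw [Adjunction.homEquiv_counit]
  refine (congrArg (fun φ : straightening X ⋙ SPresheaf.lan (pathFunctor p) ⟶
    Over.map p ⋙ straightening S => φ.app p') (Adjunction.homEquiv_counit
      ((SPresheaf.lanAdjunction (pathFunctor p)).whiskerRight (Over X)) _ _ _)).trans ?_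
  simp

lemma isIso_baseChange (p : X ⟶ S) : IsIso (baseChange p) := by
  refine (NatTrans.isIso_iff_isIso_app _).2 fun p' =>
    isIso_of_coyoneda_map_bijective _ fun Q => ?_
  -- By Yoneda, precomposition with the base change map must be bijective; followed by the bijection
  -- of the Kan extension adjunction it is the map of `restrict_bijective`.
  refine (((SPresheaf.lanAdjunction (pathFunctor p)).homEquiv _ Q).bijective.of_comp_iff' _).1 ?_
  convert restrict_bijective p' p Q using 1
  funext φ
  rw [Function.comp_apply, baseChange_app, Adjunction.homEquiv_naturality_right,
    Equiv.apply_symm_apply]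

end BaseChange

end Straightening

theorem proposition2p10 (S : SSet.{u}) :
    PreservesColimits (Straightening.straightening S) ∧
      ∀ (X : SSet.{u}) (p : X ⟶ S), IsIso (Straightening.baseChange p) := by
  exact ⟨(Straightening.strAdjunction S).leftAdjoint_preservesColimits,
    fun _ p => Straightening.isIso_baseChange p⟩
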